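/- Let $K$ be a field of characteristic zero (for example $\mathbb{C}$), let $n\ge 2$, let $Q=\{q_1<\dots<q_k\}\subseteq\{1,\dots,n-1\}$ be nonempty, and let $\lambda=(\lambda_1\ge\dots\ge\lambda_n\ge 0)$ be an $n$-partition all of whose column lengths less than $n$ belong to $Q$. Write $\zeta_1\ge\dots\ge\zeta_{\lambda_1}$ for the column lengths of the shape of $\lambda$. A $Q$-chain is a sequence $\pi=(P_1\subset\dots\subset P_k)$ of subsets of $[n]=\{1,\dots,n\}$ with $|P_j|=q_j$; fix one. A tabloid of shape $\lambda$ is a filling $T$ of the shape with values $T(r,c)\in[n]$ (row $r$, column $c$) that strictly increase down each column; it is a tableau if moreover its values weakly increase along each row. Write $T\preceq U$ if $T(r,c)\le U(r,c)$ at all locations. The $\lambda$-key $Y_\lambda(\pi)$ is the tabloid of shape $\lambda$ in which each column of length $n$ is filled with $[n]$ and each column of length $q_j$ is filled with $P_j$, in increasing order. The scanning tableau $S(T)$ of a tableau $T$ is found as follows. The earliest weakly increasing subsequence of a sequence $b_1,b_2,\dots$ starts with $b_1$, and after each chosen member continues with the first later member that is at least as large. To fill column $c$ of $S(T)$, ignore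 the columns of $T$ to the left of column $c$ and start with all other locations unmarked. Repeatedly take the sequence, from left to right, of the values at the bottom-most unmarked locations of the columns (of those that still have an unmarked location), put the last member of its earliest weakly increasing subsequence into the lowest empty location of column $c$ of $S(T)$, and mark the locations of all members of that subsequence, until column $c$ of $S(T)$ is full. The tableau $T$ is $\pi$-Demazure if $S(T)\preceq Y_\lambda(\pi)$. The monomial of a tabloid $T$ is the polynomial $\tau_T=\prod_{c=1}^{\lambda_1}\det\bigl(x_{T(i,c),\,j}\bigr)_{1\le i,j\le \zeta_c}$ in the $n^2$ variables $x_{ij}$, over $K$. Let $\Gamma_\lambda$ be the span of the monomials of all tabloids of shape $\lambda$, let $Z_\lambda(\pi)\subseteq\Gamma_\lambda$ be the span of the monomials of those $T$ with $T\not\preceq Y_\lambda(\pi)$, and let $\Gamma_\lambda(\pi)=\Gamma_\lambda/Z_\lambda(\pi)$. Let $H\subset GL_n(K)$ be the group of invertible diagonal matrices, acting on polynomials in the entries of an $n\times n$ matrix $f$ by $(h.p)(f)=p(h^{-1}f)$. This action preserves $\Gamma_\lambda$ and $Z_\lambda(\pi)$, and so it induces a representation of $H$ on the finite-dimensional space $\Gamma_\lambda(\pi)$.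 Then the character of $H$ on $\Gamma_\lambda(\pi)$ is $\sum_T y^T$, where the sum runs over all $\pi$-Demazure tableaux $T$ of shape $\lambda$ and $y^T=\prod_{i=1}^n y_i^{c_i(T)}$, with $c_i(T)$ the number of values of $T$ equal to $i$. That is, for all $y_1,\dots,y_n\in K^\times$, the trace of the element $\mathrm{diag}(y_1^{-1},\dots,y_n^{-1})$ of $H$ on $\Gamma_\lambda(\pi)$ equals $\sum_T y^T$. -/

import Mathlib

/-- The number of columns of the shape of `lam`: the largest part `λ₁`. -/
def numCols {n : ℕ} (lam : Fin n → ℕ) : ℕ := Finset.univ.sup lam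

/-- The length `ζ_c` of column `c` (columns and rows are numbered from `0`) of the shape of `lam`:
the number of rows `r` that have a box in column `c`. -/
def colLen {n : ℕ} (lam : Fin n → ℕ) (c : ℕ) : ℕ :=
  (Finset.univ.filter fun r : Fin n => c < lam r).card

theorem colLen_le {n : ℕ} (lam : Fin n → ℕ) (c : ℕ) : colLen lam c ≤ n :=
  (Finset.card_le_univ _).trans_eq (Fintype.card_fin n)

/-- The set `Q(λ)` of the distinct column lengths of the shape of `lam` that are less than `n`. -/
def colLengths {n : ℕ} (lam : Fin n → ℕ) : Finset ℕ :=
  ((Finset.range (numCols lam)).image (colLen lam)).filter (· < n)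

/-- A tabloid of shape `lam`: each column `c` is filled with a strictly increasing sequence of
values. The value `i + 1` in `{1, …, n}` is represented by `i : Fin n`. -/
abbrev Tabloid {n : ℕ} (lam : Fin n → ℕ) : Type :=
  (c : Fin (numCols lam)) → (Fin (colLen lam c) ↪o Fin n)

instance {n : ℕ} (lam : Fin n → ℕ) : Finite (Tabloid lam) :=
  Finite.of_injective (fun T : Tabloid lam => fun c : Fin (numCols lam) => (T c : Fin (colLen lam c) → Fin n))
    (fun T U h => funext fun c => DFunLike.coe_injective (congrFun h c))

noncomputable instance {n : ℕ} (lam : Fin n → ℕ) : Fintype (Tabloid lam) := Fintype.ofFinite _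

namespace Tabloid

variable {n : ℕ} {lam : Fin n → ℕ}

/-- The entry `T(r, c)` in row `r` and column `c` as a natural number; the value outside of the
shape is irrelevant. -/
def entry (T : Tabloid lam) (r c : ℕ) : ℕ :=
  if h : c < numCols lam ∧ r < colLen lam c then ((T ⟨c, h.1⟩ ⟨r, h.2⟩ : Fin n) : ℕ) else 0

/-- The order `T ⪯ U`: comparison at every location of the shape. -/
def Below (T U : Tabloid lam) : Prop :=
  ∀ (c : Fin (numCols lam)) (r : Fin (colLen lam c)), T c r ≤ U c r

/-- A (semistandard Young) tableau is a tabloid whose values weakly increase across each row. -/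
def IsTableau (T : Tabloid lam) : Prop :=
  ∀ (c d : Fin (numCols lam)), c ≤ d → ∀ (r : ℕ) (hc : r < colLen lam c) (hd : r < colLen lam d),
    T c ⟨r, hc⟩ ≤ T d ⟨r, hd⟩

/-- The number of locations of `T` with the value `i`. -/
def content (T : Tabloid lam) (i : Fin n) : ℕ :=
  ∑ c, (Finset.univ.filter fun r => T c r = i).card

/-- The monomial of a tabloid: the product over the columns `c` of the `ζ_c`-initial minor (on the
first `ζ_c` columns of the generic `n × n` matrix) with rows given by the values in column `c`. -/
noncomputable def monomial (K : Type*) [Field K] (T : Tabloid lam) :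
    MvPolynomial (Fin n × Fin n) K :=
  ∏ c : Fin (numCols lam),
    (Matrix.of fun i j : Fin (colLen lam c) =>
      (MvPolynomial.X (T c i, Fin.castLE (colLen_le lam c) j) :
        MvPolynomial (Fin n × Fin n) K)).det

end Tabloid

/-! ### The scanning tableau -/

/-- The continuation of the earliest weakly increasing subsequence after a last chosen member `a`,
for a list of indices whose values are given by `val`. -/
def ewisFrom (val : ℕ → ℕ) : ℕ → List ℕ → List ℕ
  | _, [] => []
  | a, b :: l => if val a ≤ val b then b :: ewisFrom val b l else ewisFrom val a l

/-- The earliest weakly increasing subsequence (as a list of indices) of the sequence of values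
`val i`, for `i` in the given list of indices. -/
def ewis (val : ℕ → ℕ) : List ℕ → List ℕ
  | [] => []
  | a :: l => a :: ewisFrom val a l

/-- The scanning path in a filling `t` with `w` columns, of which the columns before `c` are
ignored and in column `j` of which the top `len j` locations are unmarked. The path is
encoded by the list of the columns that it meets; in column `j` it meets the bottom-most unmarked
location, which is in row `len j - 1`. -/
def scanPath (t : ℕ → ℕ → ℕ) (w c : ℕ) (len : ℕ → ℕ) : List ℕ :=
  ewis (fun j => t (len j - 1) j) ((List.range' c (w - c)).filter fun j => 0 < len j)

/-- The number of unmarked locations in each column after `s` scanning paths have been marked, when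
the columns before `c` are ignored and the columns have the lengths `ζ`. -/
def scanLen (t : ℕ → ℕ → ℕ) (w : ℕ) (ζ : ℕ → ℕ) (c : ℕ) : ℕ → ℕ → ℕ
  | 0 => ζ
  | s + 1 => fun j =>
      if j ∈ scanPath t w c (scanLen t w ζ c s) then scanLen t w ζ c s j - 1
      else scanLen t w ζ c s j

/-- The value at row `r` and column `c` of the scanning tableau of a filling `t` with `w` columns of
lengths `ζ`: column `c` is filled from its bottom, so this is the last value of the scanning path
that is found when `ζ c - 1 - r` paths have been marked. -/
def scanEntry (t : ℕ → ℕ → ℕ) (w : ℕ) (ζ : ℕ → ℕ) (r c : ℕ) : ℕ :=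
  match (scanPath t w c (scanLen t w ζ c (ζ c - 1 - r))).getLast? with
  | some j => t (scanLen t w ζ c (ζ c - 1 - r) j - 1) j
  | none => 0

/-- The entry in row `r` and column `c` of the scanning tableau `S(T)`. -/
def Tabloid.scanning {n : ℕ} {lam : Fin n → ℕ} (T : Tabloid lam) (r c : ℕ) : ℕ :=
  scanEntry T.entry (numCols lam) (colLen lam) r c

/-! ### Chains and keys -/

/-- A `Q`-chain: an increasing family of subsets of `[n]`, one of each size `q ∈ Q`. -/
structure QChain (n : ℕ) (Q : Finset ℕ) where
  /-- the subset of size `q` -/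
  sets : Q → Finset (Fin n)
  card_sets : ∀ q, (sets q).card = q
  mono : Monotone sets

namespace QChain

variable {n : ℕ} {Q : Finset ℕ}

/-- The set of values in a column of length `d` of a key of `π`: the member of the chain of size
`d` if `d ∈ Q`, and `[n]` otherwise (where the only relevant length is `d = n`). -/
def keySet (π : QChain n Q) (d : ℕ) : Finset (Fin n) :=
  if h : d ∈ Q then π.sets ⟨d, h⟩ else Finset.univ

theorem card_keySet (π : QChain n Q) {lam : Fin n → ℕ} (hQ : colLengths lam ⊆ Q)
    (c : Fin (numCols lam)) : (π.keySet (colLen lam c)).card = colLen lam c := by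
  unfold keySet
  split_ifs with h
  · exact π.card_sets _
  · rw [Finset.card_univ, Fintype.card_fin]
    by_contra hne
    refine h (hQ ?_)
    refine Finset.mem_filter.2 ⟨Finset.mem_image.2 ⟨c, Finset.mem_range.2 c.2, rfl⟩, ?_⟩
    exact lt_of_le_of_ne (colLen_le lam c) (Ne.symm hne)

/-- The `λ`-key of `π`: the tabloid of shape `lam` in which each column of length `n` is
filled with `[n]`, and each column of length `q ∈ Q` with the member of the chain of size `q`. -/
def lambdaKey (π : QChain n Q) {lam : Fin n → ℕ} (hQ : colLengths lam ⊆ Q) : Tabloid lam :=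
  fun c => (π.keySet (colLen lam c)).orderEmbOfFin (π.card_keySet hQ c)

end QChain

/-- A tabloid `T` is a `π`-Demazure tableau if it is a tableau and `S(T) ⪯ Y_λ(π)`. -/
def IsDemazure {n : ℕ} {lam : Fin n → ℕ} {Q : Finset ℕ} (hQ : colLengths lam ⊆ Q)
    (π : QChain n Q) (T : Tabloid lam) : Prop :=
  T.IsTableau ∧ ∀ (c : Fin (numCols lam)) (r : Fin (colLen lam c)),
    T.scanning r c ≤ (π.lambdaKey hQ c r : ℕ)

open scoped Classical in
/-- The finite set of the `π`-Demazure tableaux of shape `lam`. -/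
noncomputable def demazureTableaux {n : ℕ} {lam : Fin n → ℕ} {Q : Finset ℕ}
    (hQ : colLengths lam ⊆ Q) (π : QChain n Q) : Finset (Tabloid lam) :=
  Finset.univ.filter (IsDemazure hQ π)

/-! ### The spaces `Γ_λ` and `Γ_λ(π)` -/

section Spaces

variable (K : Type*) [Field K] {n : ℕ} (lam : Fin n → ℕ)

/-- The span `Γ_λ` of the monomials of the tabloids of shape `lam`. -/
noncomputable def gammaSpace : Submodule K (MvPolynomial (Fin n × Fin n) K) :=
  Submodule.span K (Set.range fun T : Tabloid lam => T.monomial K)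

instance : FiniteDimensional K (gammaSpace K lam) :=
  FiniteDimensional.span_of_finite K (Set.finite_range _)

variable {lam} {Q : Finset ℕ} (hQ : colLengths lam ⊆ Q) (π : QChain n Q)

/-- The subspace `Z_λ(π)` of `Γ_λ`: the span of the monomials of the tabloids `T` such that
`T ⪯ Y_λ(π)` does not hold. -/
noncomputable def zSpace : Submodule K (gammaSpace K lam) :=
  Submodule.span K {p | ∃ T : Tabloid lam, ¬ T.Below (π.lambdaKey hQ) ∧
    (p : MvPolynomial (Fin n × Fin n) K) = T.monomial K}

/-- The Demazure quotient `Γ_λ(π) = Γ_λ / Z_λ(π)`. -/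
abbrev DemazureQuotient : Type _ := gammaSpace K lam ⧸ zSpace K hQ π

end Spaces

/-! ### The torus and its action -/

section Torus

variable (K : Type*) [Field K] (n : ℕ)

/-- The homomorphism that sends an `n`-tuple of units to the diagonal matrix with these entries. -/
def diagHom : (Fin n → Kˣ) →* GL (Fin n) K :=
  (Units.map (Matrix.diagonalRingHom (Fin n) K).toMonoidHom).comp
    (MulEquiv.piUnits (M := fun _ : Fin n => K)).symm.toMonoidHom

theorem coe_diagHom (y : Fin n → Kˣ) :
    (diagHom K n y : Matrix (Fin n) (Fin n) K) = Matrix.diagonal fun i => (y i : K) := rfl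

/-- The group `H` of the invertible diagonal matrices. -/
def torus : Subgroup (GL (Fin n) K) := (diagHom K n).range

variable {K n}

/-- The element `diag(y₁⁻¹, …, y_n⁻¹)` of `H`. -/
def torusElt (y : Fin n → Kˣ) : torus K n := ⟨diagHom K n y⁻¹, ⟨_, rfl⟩⟩

variable (K n)

variable {n} in
/-- The substitution `p(x) ↦ p(A x)` on polynomials in the entries `x_{ij}` of a generic matrix `x`:
the variable `x_{ij}` is replaced by the entry `(i, j)` of `A x`. -/
noncomputable def leftSubst (A : Matrix (Fin n) (Fin n) K) :
    MvPolynomial (Fin n × Fin n) K →ₐ[K] MvPolynomial (Fin n × Fin n) K :=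
  MvPolynomial.aeval fun ij => ∑ k, MvPolynomial.C (A ij.1 k) * MvPolynomial.X (k, ij.2)

/-- The action of `GL_n` on polynomials in the entries of an `n × n` matrix `f`, given by
`(g • p)(f) = p(g⁻¹ f)`. -/
noncomputable def polyRep : Representation K (GL (Fin n) K) (MvPolynomial (Fin n × Fin n) K) where
  toFun g := (leftSubst K (g⁻¹ : GL (Fin n) K).1).toLinearMap
  map_one' := by
    have : leftSubst K ((1 : GL (Fin n) K)⁻¹ : GL (Fin n) K).1 = AlgHom.id K _ := by
      apply MvPolynomial.algHom_ext
      intro ij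
      simp [leftSubst, Matrix.one_apply]
    rw [this]; rfl
  map_mul' g h := by
    rw [Module.End.mul_eq_comp, ← AlgHom.comp_toLinearMap]
    congr 1
    apply MvPolynomial.algHom_ext
    intro ij
    simp only [leftSubst, mul_inv_rev, MvPolynomial.aeval_X, AlgHom.comp_apply, map_sum, map_mul,
      Units.val_mul, Matrix.mul_apply, Finset.sum_mul, Finset.mul_sum, MvPolynomial.algHom_C,
      MvPolynomial.algebraMap_eq]
    rw [Finset.sum_comm]
    simp only [mul_assoc]

/-- The action of `H` on polynomials: `(h • p)(f) = p(h⁻¹ f)`. -/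
noncomputable def torusRep : Representation K (torus K n) (MvPolynomial (Fin n × Fin n) K) :=
  (polyRep K n).comp (torus K n).subtype

variable {K n}

theorem torusRep_monomial (h : torus K n) {lam : Fin n → ℕ} (T : Tabloid lam) :
    ∃ a : K, torusRep K n h (T.monomial K) = a • T.monomial K := by
  obtain ⟨g, z, rfl⟩ := h
  refine ⟨∏ c, ∏ i, ((z⁻¹ (T c i) : Kˣ) : K), ?_⟩
  have hX : ∀ i j, leftSubst K (diagHom K n z⁻¹).1 (MvPolynomial.X (i, j)) =
      MvPolynomial.C ((z⁻¹ i : Kˣ) : K) * MvPolynomial.X (i, j) := by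
    intro i j
    rw [leftSubst, MvPolynomial.aeval_X]
    simp only [coe_diagHom]
    rw [Finset.sum_eq_single i]
    · simp
    · intro b _ hb
      simp [Matrix.diagonal_apply_ne' _ hb]
    · simp
  have hφ : torusRep K n ⟨diagHom K n z, z, rfl⟩ (T.monomial K) =
      leftSubst K (diagHom K n z⁻¹).1 (T.monomial K) := rfl
  refine hφ.trans ?_
  unfold Tabloid.monomial
  rw [map_prod, MvPolynomial.smul_eq_C_mul, map_prod, ← Finset.prod_mul_distrib]
  refine Finset.prod_congr rfl fun c _ => ?_
  rw [AlgHom.map_det, map_prod, ← Matrix.det_mul_column]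
  congr 1
  ext1 i j
  simp only [AlgHom.mapMatrix_apply, Matrix.map_apply, Matrix.of_apply, hX]

theorem gammaSpace_invariant (lam : Fin n → ℕ) (h : torus K n) :
    gammaSpace K lam ≤ (gammaSpace K lam).comap (torusRep K n h) := by
  refine Submodule.span_le.2 ?_
  rintro _ ⟨T, rfl⟩
  obtain ⟨a, ha⟩ := torusRep_monomial h T
  refine Submodule.mem_comap.2 ?_
  rw [ha]
  exact Submodule.smul_mem _ _ (Submodule.subset_span ⟨T, rfl⟩)

variable (K)

/-- The representation of `H` on `Γ_λ`. -/
noncomputable def gammaRep (lam : Fin n → ℕ) : Representation K (torus K n) (gammaSpace K lam) :=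
  (torusRep K n).subrepresentation (gammaSpace K lam) (gammaSpace_invariant lam)

variable {lam : Fin n → ℕ} {Q : Finset ℕ} (hQ : colLengths lam ⊆ Q) (π : QChain n Q)

theorem zSpace_invariant (h : torus K n) :
    zSpace K hQ π ≤ (zSpace K hQ π).comap (gammaRep K lam h) := by
  refine Submodule.span_le.2 ?_
  rintro p ⟨T, hT, hp⟩
  obtain ⟨a, ha⟩ := torusRep_monomial h T
  have : gammaRep K lam h p = a • p := by
    apply Subtype.ext
    change torusRep K n h (p : MvPolynomial (Fin n × Fin n) K) = _
    rw [hp, ha, ← hp]; rfl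
  refine Submodule.mem_comap.2 ?_
  rw [this]
  exact Submodule.smul_mem _ _ (Submodule.subset_span ⟨T, hT, hp⟩)

/-- The representation of `H` that is induced on the Demazure quotient `Γ_λ(π)`. -/
noncomputable def demazureRep : Representation K (torus K n) (DemazureQuotient K hQ π) :=
  (gammaRep K lam).quotient (zSpace K hQ π) (zSpace_invariant K hQ π)

end Torus

/-! The torus scales the monomial of every tabloid `T` by its weight `y^T`, so it suffices that the
classes of the monomials of the π-Demazure tableaux form a basis of the quotient. This is standard
monomial theory for a Schubert variety.

Choose a permutation `w` whose initial sets of values `w[q] = permSet w q` are the members of the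
chain. The polynomials that vanish on all products `b w u` with `b`, `u` upper triangular form a
prime ideal `schubertIdeal`. The initial minor of `S` lies in it unless `S` is Gale-below `w[|S|]`,
and the minor of `w[q]` does not; hence `Z_λ(π)` lies in the ideal. For a column `C` below `w[|C|]`
there is a permutation `w ∧ C`, with a larger ideal, whose initial sets of size `q ≥ |C|` are the
Gale-largest sets below `w[q]` that contain `C` (`exists_isMeet`). A sequence of columns is standard
for `w` if its last column `C` is below `w` and the other columns are standard for `w ∧ C`.

Independence (`IsStandard.linearIndependent`): in a relation, let `B` be a last column with the
least sum of entries. Modulo the ideal of `w ∧ B` all terms with another last column vanish; the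
minor of `B` can be cancelled by primality, and a shorter relation remains.

Spanning (`columnProd_mem_standardSpan_sup`): straighten the columns before the last column `B` with
respect to `w ∧ B`. The terms left over contain a minor not supported by `w ∧ B`. The quadratic
relation `initialMinor_mul_mem_span` rewrites its product with the minor of `B` by terms not
supported by `w` and terms with a larger last column.

Finally, meeting with `C` is adjoint to inserting `C`, that is, to passing to the smallest set above
a given one that contains `C`. Scanning from column `c` performs the insertions of the columns to
its right one after the other. Hence, for a tableau, `S(T) ⪯ Y_λ(π)` is standardness
(`IsTableau.scanning_le_iff`), and standard sequences are automatically tableaux. -/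

/-! ### Row minors and the exchange relation -/

section Exchange

open MvPolynomial

variable (K : Type*) [Field K] {n : ℕ}

/-- The minor of the generic matrix on the rows `u 0, …, u (q - 1)` and the first `q` columns. -/
noncomputable def rowMinor {q : ℕ} (hq : q ≤ n) (u : Fin q → Fin n) :
    MvPolynomial (Fin n × Fin n) K :=
  (Matrix.of fun i j : Fin q => (X (u i, Fin.castLE hq j) : MvPolynomial (Fin n × Fin n) K)).det

/-- The product of two row minors whose rows are given by a single word. -/
noncomputable def pairMinor {q r : ℕ} (hq : q ≤ n) (hr : r ≤ n) (z : Fin q ⊕ Fin r → Fin n) :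
    MvPolynomial (Fin n × Fin n) K :=
  rowMinor K hq (z ∘ Sum.inl) * rowMinor K hr (z ∘ Sum.inr)

/-- Cramer's rule expresses the row `z (inr g)`, times the first minor, through the rows of the
first matrix; linearity of the second minor in its row `g` then distributes the sum. Since `r ≤ q`,
truncated rows of the first matrix can serve as rows of the second. -/
theorem pairMinor_exchange {q r : ℕ} (hq : q ≤ n) (hr : r ≤ n) (hrq : r ≤ q)
    (z : Fin q ⊕ Fin r → Fin n) (g : Fin r) :
    pairMinor K hq hr z =
      ∑ f : Fin q, pairMinor K hq hr (z ∘ Equiv.swap (Sum.inl f) (Sum.inr g)) := by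
  set M : Matrix (Fin q) (Fin q) (MvPolynomial (Fin n × Fin n) K) :=
    Matrix.of fun i j => X (z (Sum.inl i), Fin.castLE hq j) with hM
  set N : Matrix (Fin r) (Fin r) (MvPolynomial (Fin n × Fin n) K) :=
    Matrix.of fun i j => X (z (Sum.inr i), Fin.castLE hr j) with hN
  set x : Fin q → MvPolynomial (Fin n × Fin n) K :=
    fun j => X (z (Sum.inr g), Fin.castLE hq j) with hx
  have h1 : ∀ f : Fin q, pairMinor K hq hr (z ∘ Equiv.swap (Sum.inl f) (Sum.inr g)) =
      Matrix.cramer M.transpose x f *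
        Matrix.cramer N.transpose (fun j => M f (Fin.castLE hrq j)) g := by
    intro f
    rw [Matrix.cramer_transpose_apply, Matrix.cramer_transpose_apply]
    unfold pairMinor rowMinor
    congr 2
    · ext1 i j
      by_cases hi : i = f
      · subst hi; simp [hx]
      · simp [hi, hM, Equiv.swap_apply_of_ne_of_ne]
    · ext1 i j
      by_cases hi : i = g
      · subst hi; simp [hM]
      · simp [hi, hN, Equiv.swap_apply_of_ne_of_ne]
  have h2 : ∀ j, ∑ f, Matrix.cramer M.transpose x f * M f j = M.det * x j := by
    intro j
    have := congrFun (Matrix.mulVec_cramer M.transpose x) j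
    rw [Matrix.det_transpose] at this
    simpa [Matrix.mulVec, dotProduct, mul_comm] using this
  calc pairMinor K hq hr z = M.det * N.det := rfl
    _ = M.det * Matrix.cramer N.transpose (fun j => x (Fin.castLE hrq j)) g := by
        rw [Matrix.cramer_transpose_apply]
        congr 2
        ext1 i j
        by_cases hi : i = g
        · subst hi; simp [hx, hN]
        · simp [hi]
    _ = Matrix.cramer N.transpose (∑ f, Matrix.cramer M.transpose x f •
          fun j => M f (Fin.castLE hrq j)) g := by
        have : (∑ f, Matrix.cramer M.transpose x f • fun j : Fin r => M f (Fin.castLE hrq j)) =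
            M.det • fun j => x (Fin.castLE hrq j) := by
          ext1 j
          simp only [Finset.sum_apply, Pi.smul_apply, smul_eq_mul]
          exact h2 _
        rw [this, map_smul]
        rfl
    _ = _ := by
        rw [map_sum, Finset.sum_apply]
        refine Finset.sum_congr rfl fun f _ => ?_
        rw [map_smul, h1]; rfl

/-- The alternating sum of the products of two row minors over the permutations of the positions
in `A`. -/
noncomputable def altSum {q r : ℕ} (hq : q ≤ n) (hr : r ≤ n) (A : Finset (Fin q ⊕ Fin r))
    (z : Fin q ⊕ Fin r → Fin n) : MvPolynomial (Fin n × Fin n) K :=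
  ∑ σ : Equiv.Perm (Fin q ⊕ Fin r) with ∀ x, x ∉ A → σ x = x,
    (Equiv.Perm.sign σ : ℤ) • pairMinor K hq hr (z ∘ σ)

variable {K}

theorem perm_symm_mem_of_fixes_compl {α : Type*} {A : Finset α} {σ : Equiv.Perm α}
    (hσ : ∀ x, x ∉ A → σ x = x) {a : α} (ha : a ∈ A) : σ.symm a ∈ A := by
  by_contra h
  have := hσ _ h
  rw [Equiv.apply_symm_apply] at this
  rw [← this] at h
  exact h ha

/-- Right multiplication by a transposition inside `A` permutes the summands and reverses the sign.
-/
theorem altSum_swap_of_mem {q r : ℕ} (hq : q ≤ n) (hr : r ≤ n) (A : Finset (Fin q ⊕ Fin r))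
    (z : Fin q ⊕ Fin r → Fin n) {f g : Fin q ⊕ Fin r} (hf : f ∈ A) (hg : g ∈ A) (hfg : f ≠ g) :
    ∑ σ : Equiv.Perm (Fin q ⊕ Fin r) with ∀ x, x ∉ A → σ x = x,
      (Equiv.Perm.sign σ : ℤ) • pairMinor K hq hr ((z ∘ σ) ∘ Equiv.swap f g) =
      - altSum K hq hr A z := by
  have hfix : ∀ x, x ∉ A → Equiv.swap f g x = x := fun x hx =>
    Equiv.swap_apply_of_ne_of_ne (fun h => hx (h ▸ hf)) (fun h => hx (h ▸ hg))
  unfold altSum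
  rw [← Finset.sum_neg_distrib]
  refine Finset.sum_bij' (fun σ _ => σ * Equiv.swap f g) (fun σ _ => σ * Equiv.swap f g)
    ?_ ?_ ?_ ?_ ?_
  · intro σ hσ
    simp only [Finset.mem_filter, Finset.mem_univ, true_and] at hσ ⊢
    intro x hx
    rw [Equiv.Perm.mul_apply, hfix x hx, hσ x hx]
  · intro σ hσ
    simp only [Finset.mem_filter, Finset.mem_univ, true_and] at hσ ⊢
    intro x hx
    rw [Equiv.Perm.mul_apply, hfix x hx, hσ x hx]
  · intro σ _; ext x; simp
  · intro σ _; ext x; simp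
  · intro σ _
    rw [Equiv.Perm.sign_mul, Equiv.Perm.sign_swap hfg]
    simp [Function.comp_assoc]

/-- Conjugation by `τ` preserves signs and carries the permutations supported in `A` to those
supported in the transported set of positions. -/
theorem altSum_swap_of_notMem {q r : ℕ} (hq : q ≤ n) (hr : r ≤ n) (A : Finset (Fin q ⊕ Fin r))
    (z : Fin q ⊕ Fin r → Fin n) (τ : Equiv.Perm (Fin q ⊕ Fin r)) :
    ∑ σ : Equiv.Perm (Fin q ⊕ Fin r) with ∀ x, x ∉ A → σ x = x,
      (Equiv.Perm.sign σ : ℤ) • pairMinor K hq hr ((z ∘ σ) ∘ τ) =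
      altSum K hq hr (A.map τ.symm.toEmbedding) (z ∘ τ) := by
  unfold altSum
  refine Finset.sum_bij' (fun σ _ => τ⁻¹ * σ * τ) (fun σ _ => τ * σ * τ⁻¹) ?_ ?_ ?_ ?_ ?_
  · intro σ hσ
    simp only [Finset.mem_filter, Finset.mem_univ, true_and] at hσ ⊢
    intro x hx
    have : τ x ∉ A := fun h => hx (Finset.mem_map.2 ⟨_, h, by simp⟩)
    simp [hσ _ this]
  · intro σ hσ
    simp only [Finset.mem_filter, Finset.mem_univ, true_and] at hσ ⊢
    intro x hx
    have : τ⁻¹ x ∉ A.map τ.symm.toEmbedding := by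
      intro h
      obtain ⟨y, hy, hxy⟩ := Finset.mem_map.1 h
      exact hx (τ.symm.injective hxy ▸ hy)
    rw [Equiv.Perm.mul_apply, Equiv.Perm.mul_apply, hσ _ this]
    exact τ.apply_symm_apply x
  · intro σ _; ext x; simp
  · intro σ _; ext x; simp
  · intro σ _
    congr 1
    · rw [Equiv.Perm.sign_mul, Equiv.Perm.sign_mul, Equiv.Perm.sign_inv, mul_right_comm,
        Int.units_mul_self, one_mul]
    · congr 1
      ext x; simp

/-- An alternating sum of products of two row minors is a combination of products in which the
first factor involves all the alternated rows. -/
theorem altSum_mem_span [CharZero K] {q r : ℕ} (hq : q ≤ n) (hr : r ≤ n) (hrq : r ≤ q)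
    (A : Finset (Fin q ⊕ Fin r)) (z : Fin q ⊕ Fin r → Fin n) :
    altSum K hq hr A z ∈ Submodule.span K {p | ∃ τ : Equiv.Perm (Fin q ⊕ Fin r),
      (∀ a ∈ A, ∃ i, τ (Sum.inl i) = a) ∧ p = pairMinor K hq hr (z ∘ τ)} := by
  induction hm : (A.filter fun x => x.isRight).card generalizing A z with
  | zero =>
    have hA : ∀ a ∈ A, ∃ i, a = Sum.inl i := by
      intro a ha
      cases a with
      | inl i => exact ⟨i, rfl⟩
      | inr j =>
        rw [Finset.card_eq_zero, Finset.filter_eq_empty_iff] at hm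
        exact absurd rfl (hm ha)
    refine Submodule.sum_mem _ fun σ hσ => ?_
    rw [Finset.mem_filter] at hσ
    rw [← Int.cast_smul_eq_zsmul K]
    refine Submodule.smul_mem _ _ (Submodule.subset_span ⟨σ, fun a ha => ?_, rfl⟩)
    obtain ⟨i, hi⟩ := hA _ (perm_symm_mem_of_fixes_compl hσ.2 ha)
    exact ⟨i, by rw [← hi]; simp⟩
  | succ m ih =>
    obtain ⟨g, hg⟩ : ∃ g, Sum.inr g ∈ A := by
      have : (A.filter fun x => x.isRight).Nonempty := Finset.card_pos.1 (by omega)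
      obtain ⟨x, hx⟩ := this
      rw [Finset.mem_filter] at hx
      cases x with
      | inl i => simp at hx
      | inr j => exact ⟨j, hx.1⟩
    -- The exchange relation is applied at the right position `g` to every term.
    have key : altSum K hq hr A z = ∑ f : Fin q,
        ∑ σ : Equiv.Perm (Fin q ⊕ Fin r) with ∀ x, x ∉ A → σ x = x,
        (Equiv.Perm.sign σ : ℤ) •
          pairMinor K hq hr ((z ∘ σ) ∘ Equiv.swap (Sum.inl f) (Sum.inr g)) := by
      rw [Finset.sum_comm]
      refine Finset.sum_congr rfl fun σ _ => ?_
      rw [← Finset.smul_sum, ← pairMinor_exchange K hq hr hrq]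
    rw [← Finset.sum_filter_add_sum_filter_not Finset.univ
      (fun f : Fin q => (Sum.inl f : Fin q ⊕ Fin r) ∈ A)] at key
    -- Each of the `k` positions `f` in `A` contributes `-altSum`, which gives `(k + 1) • altSum` on
    -- the left; characteristic zero allows division. For the other `f`, the set `A` has `g`
    -- replaced with `f` and so one right position fewer.
    rw [Finset.sum_congr rfl (g := fun _ => - altSum K hq hr A z) (fun f hf =>
      altSum_swap_of_mem hq hr A z (Finset.mem_filter.1 hf).2 hg (by simp)),
      Finset.sum_const, smul_neg, neg_add_eq_sub, eq_sub_iff_add_eq] at key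
    set k := (Finset.univ.filter fun f : Fin q => (Sum.inl f : Fin q ⊕ Fin r) ∈ A).card
    have hk : ((k + 1 : ℕ) : K) ≠ 0 := Nat.cast_ne_zero.2 (Nat.succ_ne_zero k)
    have key2 : altSum K hq hr A z = ((k + 1 : ℕ) : K)⁻¹ • ((k + 1 : ℕ) : K) •
        altSum K hq hr A z := by rw [smul_smul, inv_mul_cancel₀ hk, one_smul]
    rw [key2, Nat.cast_smul_eq_nsmul, add_smul, one_smul,
      add_comm (k • _), key]
    refine Submodule.smul_mem _ _ (Submodule.sum_mem _ fun f hf => ?_)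
    rw [altSum_swap_of_notMem]
    refine Submodule.span_mono ?_ (ih _ _ ?_)
    · rintro _ ⟨τ, hτ, rfl⟩
      refine ⟨Equiv.swap (Sum.inl f) (Sum.inr g) * τ, fun a ha => ?_, rfl⟩
      obtain ⟨i, hi⟩ := hτ _ (Finset.mem_map_of_mem _ ha)
      exact ⟨i, by simp [hi]⟩
    · have hfA : (Sum.inl f : Fin q ⊕ Fin r) ∉ A := (Finset.mem_filter.1 hf).2
      have : ((A.map (Equiv.swap (Sum.inl f) (Sum.inr g)).symm.toEmbedding).filter
          fun x => x.isRight) = (A.filter fun x => x.isRight).erase (Sum.inr g) := by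
        ext x
        simp only [Finset.mem_filter, Finset.mem_map_equiv, Equiv.symm_symm, Finset.mem_erase]
        cases x with
        | inl i => simp
        | inr j =>
          by_cases hj : j = g
          · subst hj; simp [hfA]
          · simp [hj, Equiv.swap_apply_of_ne_of_ne]
      rw [this, Finset.card_erase_of_mem (by simp [hg]), hm]; rfl

end Exchange

/-! ### Counting functions and the Gale order -/

/-- The number of elements of `S` that are at least `t`. -/
def cntGE {n : ℕ} (S : Finset (Fin n)) (t : ℕ) : ℕ := (S.filter fun x : Fin n => t ≤ (x : ℕ)).card

/-- The comparison of the `i`-th largest elements of two sets, in terms of counting functions. -/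
def GaleLE {n : ℕ} (S P : Finset (Fin n)) : Prop := ∀ t, cntGE S t ≤ cntGE P t

section Count

variable {n : ℕ}

theorem cntGE_image {α : Type*} [Fintype α] {u : α → Fin n} (hu : Function.Injective u) (t : ℕ) :
    cntGE (Finset.univ.image u) t = (Finset.univ.filter fun i => t ≤ (u i : ℕ)).card := by
  unfold cntGE
  rw [Finset.filter_image, Finset.card_image_of_injective _ hu]

theorem cntGE_mono {S P : Finset (Fin n)} (h : S ⊆ P) (t : ℕ) : cntGE S t ≤ cntGE P t :=
  Finset.card_le_card (Finset.filter_subset_filter _ h)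

theorem cntGE_zero (S : Finset (Fin n)) : cntGE S 0 = S.card := by simp [cntGE]

theorem cntGE_top (S : Finset (Fin n)) {t : ℕ} (ht : n ≤ t) : cntGE S t = 0 := by
  rw [cntGE, Finset.card_eq_zero, Finset.filter_eq_empty_iff]
  intro x _; have := x.2; omega

/-- The number of the elements of `S` between `s` and `t`. -/
theorem cntGE_eq_add (S : Finset (Fin n)) {s t : ℕ} (hst : s ≤ t) :
    cntGE S s = cntGE S t + (S.filter fun x : Fin n => s ≤ (x : ℕ) ∧ (x : ℕ) < t).card := by
  unfold cntGE
  rw [← Finset.card_union_of_disjoint]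
  · congr 1; ext x; simp only [Finset.mem_filter, Finset.mem_union]
    constructor
    · rintro ⟨h, h'⟩
      rcases le_or_gt t (x : ℕ) with h2 | h2
      · exact Or.inl ⟨h, h2⟩
      · exact Or.inr ⟨h, h', h2⟩
    · rintro (⟨h, h'⟩ | ⟨h, h', _⟩)
      · exact ⟨h, hst.trans h'⟩
      · exact ⟨h, h'⟩
  · rw [Finset.disjoint_left]
    intro x hx hx'
    simp only [Finset.mem_filter] at hx hx'
    omega

theorem cntGE_antitone (S : Finset (Fin n)) : Antitone (cntGE S) := fun s t h => by
  rw [cntGE_eq_add S h]; omega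

/-- For a subset, the counts between two thresholds compare. -/
theorem cntGE_subset_diff {S P : Finset (Fin n)} (h : S ⊆ P) {s t : ℕ} (hst : s ≤ t) :
    cntGE P t + cntGE S s ≤ cntGE P s + cntGE S t := by
  rw [cntGE_eq_add S hst, cntGE_eq_add P hst]
  have := Finset.card_le_card (Finset.filter_subset_filter
    (fun x : Fin n => s ≤ (x : ℕ) ∧ (x : ℕ) < t) h)
  omega

theorem cntGE_insert {S : Finset (Fin n)} {b : Fin n} (hb : b ∉ S) (t : ℕ) :
    cntGE (insert b S) t = cntGE S t + if t ≤ (b : ℕ) then 1 else 0 := by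
  unfold cntGE
  rw [Finset.filter_insert]
  split_ifs
  · rw [Finset.card_insert_of_notMem (by simp [hb])]
  · rfl

/-- The sum of the elements is the sum of the counts over all positive thresholds, so termwise
inequalities between counts become equalities. -/
theorem GaleLE.eq_of_card_of_sum {S P : Finset (Fin n)} (h : GaleLE S P) (hc : S.card = P.card)
    (hs : ∑ x ∈ P, (x : ℕ) ≤ ∑ x ∈ S, (x : ℕ)) : S = P := by
  have hsum : ∀ R : Finset (Fin n), ∑ x ∈ R, (x : ℕ) = ∑ t ∈ Finset.range n, cntGE R (t + 1) := by
    intro R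
    simp only [cntGE, Finset.card_filter]
    rw [Finset.sum_comm]
    refine Finset.sum_congr rfl fun x _ => ?_
    rw [← Finset.card_filter]
    have : (Finset.range n).filter (fun t => t + 1 ≤ (x : ℕ)) = Finset.range x := by
      ext t; have := x.2; simp only [Finset.mem_filter, Finset.mem_range]; omega
    rw [this, Finset.card_range]
  have heq : ∀ t, cntGE S t = cntGE P t := by
    intro t
    cases t with
    | zero => rw [cntGE_zero, cntGE_zero, hc]
    | succ t =>
      by_cases ht : t < n
      · rw [hsum, hsum] at hs
        have := (Finset.sum_eq_sum_iff_of_le (s := Finset.range n)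
          (fun t _ => h (t + 1))).1 (le_antisymm (Finset.sum_le_sum fun t _ => h _) hs)
        exact this t (Finset.mem_range.2 ht)
      · rw [cntGE_top _ (by omega), cntGE_top _ (by omega)]
  have hmem : ∀ (R : Finset (Fin n)) (x : Fin n), x ∈ R ↔ cntGE R (x + 1) < cntGE R x := by
    intro R x
    rw [cntGE_eq_add R (Nat.le_succ x), Nat.lt_add_right_iff_pos, Finset.card_pos]
    constructor
    · intro hx; exact ⟨x, by simp [hx]⟩
    · rintro ⟨y, hy⟩
      rw [Finset.mem_filter] at hy
      have : y = x := Fin.ext (by omega)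
      exact this ▸ hy.1
  ext x
  rw [hmem, hmem, heq, heq]

/-- Two strictly decreasing sequences compare termwise iff their counting functions compare. -/
theorem count_le_iff_forall_le {q : ℕ} {a b : ℕ → ℕ}
    (ha : ∀ i j, i < j → j < q → a j < a i) (hb : ∀ i j, i < j → j < q → b j < b i) :
    (∀ t, ((Finset.range q).filter fun s => t ≤ a s).card ≤
      ((Finset.range q).filter fun s => t ≤ b s).card) ↔ ∀ s < q, a s ≤ b s := by
  constructor
  · intro h s hs
    have h1 : Finset.range (s + 1) ⊆ (Finset.range q).filter fun i => a s ≤ a i := by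
      intro i hi
      rw [Finset.mem_range] at hi
      rw [Finset.mem_filter, Finset.mem_range]
      refine ⟨by omega, ?_⟩
      rcases Nat.lt_succ_iff_lt_or_eq.1 hi with h' | rfl
      · exact (ha _ _ h' hs).le
      · exact le_rfl
    have h2 := (Finset.card_le_card h1).trans (h (a s))
    rw [Finset.card_range] at h2
    by_contra hlt
    have h3 : ((Finset.range q).filter fun i => a s ≤ b i) ⊆ Finset.range s := by
      intro i hi
      rw [Finset.mem_filter, Finset.mem_range] at hi
      rw [Finset.mem_range]
      by_contra hsi
      rcases Nat.lt_or_eq_of_le (not_lt.1 hsi) with h' | rfl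
      · have := hb _ _ h' hi.1; omega
      · omega
    have := Finset.card_le_card h3
    rw [Finset.card_range] at this
    omega
  · intro h t
    refine Finset.card_le_card fun s hs => ?_
    rw [Finset.mem_filter, Finset.mem_range] at hs ⊢
    exact ⟨hs.1, hs.2.trans (h s hs.1)⟩

end Count

/-! ### Initial minors and the quadratic relations -/

section InitialMinor

open MvPolynomial

variable (K : Type*) [Field K] {n : ℕ}

theorem card_le_of_finset_fin (S : Finset (Fin n)) : S.card ≤ n :=
  (Finset.card_le_univ S).trans_eq (Fintype.card_fin n)

/-- The initial minor with the set of rows `S`. -/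
noncomputable def initialMinor (S : Finset (Fin n)) : MvPolynomial (Fin n × Fin n) K :=
  rowMinor K (card_le_of_finset_fin S) (S.orderEmbOfFin rfl)

theorem rowMinor_comp_perm {q : ℕ} (hq : q ≤ n) (u : Fin q → Fin n) (σ : Equiv.Perm (Fin q)) :
    rowMinor K hq (u ∘ σ) = (Equiv.Perm.sign σ : ℤ) • rowMinor K hq u := by
  unfold rowMinor
  rw [zsmul_eq_mul, ← Matrix.det_permute]
  rfl

theorem rowMinor_orderEmb {q : ℕ} (hq : q ≤ n) (u : Fin q ↪o Fin n) :
    rowMinor K hq u = initialMinor K (Finset.univ.image u) := by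
  have hc : (Finset.univ.image u).card = q := by
    rw [Finset.card_image_of_injective _ u.injective, Finset.card_univ, Fintype.card_fin]
  generalize hS : Finset.univ.image u = S at hc
  subst hc
  have : u = S.orderEmbOfFin rfl :=
    Finset.orderEmbOfFin_unique' rfl fun i =>
      hS.subset (Finset.mem_image_of_mem _ (Finset.mem_univ i))
  rw [this]; rfl

/-- A row minor vanishes, or it is up to sign the initial minor of the set of its rows. -/
theorem rowMinor_eq {q : ℕ} (hq : q ≤ n) (u : Fin q → Fin n) :
    rowMinor K hq u = 0 ∨ (Function.Injective u ∧
      ∃ e : ℤ, rowMinor K hq u = e • initialMinor K (Finset.univ.image u)) := by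
  by_cases hu : Function.Injective u
  · refine Or.inr ⟨hu, ?_⟩
    set σ := Tuple.sort u
    have hm : StrictMono (u ∘ σ) :=
      (Tuple.monotone_sort u).strictMono_of_injective (hu.comp σ.injective)
    refine ⟨(Equiv.Perm.sign σ⁻¹ : ℤ), ?_⟩
    have h1 := rowMinor_orderEmb K hq (OrderEmbedding.ofStrictMono _ hm)
    have h2 : (OrderEmbedding.ofStrictMono _ hm : Fin q → Fin n) = u ∘ σ := rfl
    have h3 : Finset.univ.image (u ∘ σ) = Finset.univ.image u := by
      ext x
      simp only [Finset.mem_image, Finset.mem_univ, true_and, Function.comp_apply]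
      exact ⟨fun ⟨a, ha⟩ => ⟨_, ha⟩, fun ⟨a, ha⟩ => ⟨σ⁻¹ a, by simpa using ha⟩⟩
    rw [h2, h3] at h1
    rw [← h1, ← rowMinor_comp_perm]
    congr 1; ext x; simp
  · left
    unfold Function.Injective at hu
    push Not at hu
    obtain ⟨i, j, hij, hne⟩ := hu
    refine Matrix.det_zero_of_row_eq hne ?_
    ext1 k
    simp [hij]

variable {K}

/-- A repeated row makes a minor vanish, and otherwise sorting the rows only costs a sign. Thus
`Good` matters only for words that are injective on each side. -/
theorem pairMinor_mem_span {q r : ℕ} (hq : q ≤ n) (hr : r ≤ n) (z : Fin q ⊕ Fin r → Fin n)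
    (Good : Finset (Fin n) → Finset (Fin n) → Prop)
    (h : Function.Injective (z ∘ Sum.inl) → Function.Injective (z ∘ Sum.inr) →
      Good (Finset.univ.image (z ∘ Sum.inl)) (Finset.univ.image (z ∘ Sum.inr))) :
    pairMinor K hq hr z ∈ Submodule.span K {p | ∃ I C : Finset (Fin n), I.card = q ∧ C.card = r ∧
      Good I C ∧ p = initialMinor K I * initialMinor K C} := by
  unfold pairMinor
  rcases rowMinor_eq K hq (z ∘ Sum.inl) with h1 | ⟨hi1, e1, h1⟩
  · rw [h1, zero_mul]; exact Submodule.zero_mem _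
  rcases rowMinor_eq K hr (z ∘ Sum.inr) with h2 | ⟨hi2, e2, h2⟩
  · rw [h2, mul_zero]; exact Submodule.zero_mem _
  rw [h1, h2, smul_mul_smul_comm, ← Int.cast_smul_eq_zsmul K]
  refine Submodule.smul_mem _ _ (Submodule.subset_span ⟨_, _, ?_, ?_, h hi1 hi2, rfl⟩)
  · rw [Finset.card_image_of_injective _ hi1, Finset.card_univ, Fintype.card_fin]
  · rw [Finset.card_image_of_injective _ hi2, Finset.card_univ, Fintype.card_fin]

/-- Such a permutation acts separately on the two sides, and its sign cancels the signs of the two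
determinants. -/
theorem pairMinor_sumCongr {q r : ℕ} (hq : q ≤ n) (hr : r ≤ n) (z : Fin q ⊕ Fin r → Fin n)
    (σ : Equiv.Perm (Fin q ⊕ Fin r)) (hσ : ∀ i, ∃ j, σ (Sum.inr i) = Sum.inr j) :
    (Equiv.Perm.sign σ : ℤ) • pairMinor K hq hr (z ∘ σ) = pairMinor K hq hr z := by
  have hm : σ ∈ (Equiv.Perm.sumCongrHom (Fin q) (Fin r)).range := by
    refine Equiv.Perm.mem_sumCongrHom_range_of_perm_mapsTo_inl
      ((Equiv.Perm.perm_mapsTo_inl_iff_mapsTo_inr σ).2 ?_)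
    rintro _ ⟨i, rfl⟩
    obtain ⟨j, hj⟩ := hσ i
    exact ⟨j, hj.symm⟩
  obtain ⟨⟨σ₁, σ₂⟩, rfl⟩ := hm
  have h1 : (z ∘ (Equiv.Perm.sumCongrHom (Fin q) (Fin r)) (σ₁, σ₂)) ∘ Sum.inl =
      (z ∘ Sum.inl) ∘ σ₁ := by ext x; simp
  have h2 : (z ∘ (Equiv.Perm.sumCongrHom (Fin q) (Fin r)) (σ₁, σ₂)) ∘ Sum.inr =
      (z ∘ Sum.inr) ∘ σ₂ := by ext x; simp
  unfold pairMinor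
  rw [h1, h2, rowMinor_comp_perm, rowMinor_comp_perm, smul_mul_smul_comm, smul_smul]
  have : (Equiv.Perm.sign ((Equiv.Perm.sumCongrHom (Fin q) (Fin r)) (σ₁, σ₂)) : ℤ) =
      Equiv.Perm.sign σ₁ * Equiv.Perm.sign σ₂ := by
    simp [Equiv.Perm.sign_sumCongr]
  rw [this, mul_mul_mul_comm, ← mul_assoc]
  rcases Int.units_eq_one_or (Equiv.Perm.sign σ₁) with h | h <;>
    rcases Int.units_eq_one_or (Equiv.Perm.sign σ₂) with h' | h' <;> simp [h, h']

/-- A permutation that fixes the complement of a set `A`, all of whose values at the left positions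
are larger than the values at the right positions, and that does not preserve the right positions,
increases the sum of the values at the right positions. -/
theorem sum_inr_lt_of_perm {q r : ℕ} (z : Fin q ⊕ Fin r → ℕ) (A : Finset (Fin q ⊕ Fin r)) (t : ℕ)
    (hl : ∀ i, Sum.inl i ∈ A → t ≤ z (Sum.inl i)) (hr : ∀ j, Sum.inr j ∈ A → z (Sum.inr j) < t)
    (σ : Equiv.Perm (Fin q ⊕ Fin r)) (hσ : ∀ x, x ∉ A → σ x = x)
    (hne : ∃ i, ∀ j, σ (Sum.inr i) ≠ Sum.inr j) :
    ∑ j, z (Sum.inr j) < ∑ j, z (σ (Sum.inr j)) := by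
  set R : Finset (Fin q ⊕ Fin r) := Finset.univ.map Function.Embedding.inr with hR
  set S : Finset (Fin q ⊕ Fin r) := R.map σ.toEmbedding with hS
  have h1 : ∑ j, z (Sum.inr j) = ∑ x ∈ R, z x := by rw [hR, Finset.sum_map]; rfl
  have h2 : ∑ j, z (σ (Sum.inr j)) = ∑ x ∈ S, z x := by
    rw [hS, Finset.sum_map, hR, Finset.sum_map]; rfl
  have hcard : (S \ R).card = (R \ S).card := by
    have : S.card = R.card := Finset.card_map _
    have h3 := Finset.card_sdiff_add_card_inter S R
    have h4 := Finset.card_sdiff_add_card_inter R S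
    rw [Finset.inter_comm] at h4
    omega
  have hSR : ∀ x ∈ S \ R, t ≤ z x := by
    intro x hx
    rw [Finset.mem_sdiff] at hx
    cases x with
    | inr j => exact absurd (by simp [hR]) hx.2
    | inl i =>
      apply hl
      by_contra hA
      obtain ⟨y, hy, hyx⟩ := Finset.mem_map.1 hx.1
      have h5 := hσ _ hA
      have : y = Sum.inl i := σ.injective (hyx.trans h5.symm)
      rw [this] at hy
      simp [hR] at hy
  have hRS : ∀ x ∈ R \ S, z x < t := by
    intro x hx
    rw [Finset.mem_sdiff] at hx
    cases x with
    | inl i => simp [hR] at hx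
    | inr j =>
      apply hr
      by_contra hA
      exact hx.2 (Finset.mem_map.2 ⟨_, hx.1, hσ _ hA⟩)
  have hpos : 0 < (S \ R).card := by
    obtain ⟨i, hi⟩ := hne
    refine Finset.card_pos.2 ⟨σ (Sum.inr i), Finset.mem_sdiff.2 ⟨?_, ?_⟩⟩
    · exact Finset.mem_map.2 ⟨Sum.inr i, by simp [hR], rfl⟩
    · simp only [hR, Finset.mem_map, Finset.mem_univ, true_and, not_exists]
      exact fun j hj => hi j hj.symm
  rw [h1, h2, ← Finset.sum_inter_add_sum_sdiff R S, ← Finset.sum_inter_add_sum_sdiff S R,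
    Finset.inter_comm S R]
  have h6 : (S \ R).card * t ≤ ∑ x ∈ S \ R, z x := by
    simpa using Finset.card_nsmul_le_sum _ _ _ hSR
  have h7 : ∑ x ∈ R \ S, z x < (R \ S).card * t := by
    have : ∑ x ∈ R \ S, z x < ∑ x ∈ R \ S, t :=
      Finset.sum_lt_sum_of_nonempty (Finset.card_pos.1 (hcard ▸ hpos)) hRS
    simpa using this
  rw [hcard] at h6
  omega

/-- The quadratic relation that straightens a product of two initial minors, the first of which is
not below the bound that the second one imposes. -/
theorem initialMinor_mul_mem_span [CharZero K] (I C P : Finset (Fin n)) (hCI : C.card ≤ I.card)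
    {s t : ℕ} (hst : s ≤ t) (h : cntGE P s + cntGE C t < cntGE I t + cntGE C s) :
    initialMinor K I * initialMinor K C ∈ Submodule.span K {p | ∃ I' C' : Finset (Fin n),
      I'.card = I.card ∧ C'.card = C.card ∧
      (¬ GaleLE I' P ∨ ∑ x ∈ C, (x : ℕ) < ∑ x ∈ C', (x : ℕ)) ∧
      p = initialMinor K I' * initialMinor K C'} := by
  set q := I.card
  set r := C.card
  have hq : q ≤ n := card_le_of_finset_fin I
  have hr : r ≤ n := card_le_of_finset_fin C
  set u : Fin q ↪o Fin n := I.orderEmbOfFin rfl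
  set v : Fin r ↪o Fin n := C.orderEmbOfFin rfl
  have hu : Finset.univ.image u = I := by simp [u]
  have hv : Finset.univ.image v = C := by simp [v]
  set z : Fin q ⊕ Fin r → Fin n := Sum.elim u v
  -- The alternated rows are those of `I` from `t` on and those of `C` in `[s, t)`. By `h` there are
  -- more than `cntGE P s` of them, and all are at least `s`.
  set A : Finset (Fin q ⊕ Fin r) :=
    ((Finset.univ.filter fun i => t ≤ (u i : ℕ)).map Function.Embedding.inl) ∪
      ((Finset.univ.filter fun j => s ≤ (v j : ℕ) ∧ (v j : ℕ) < t).map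
        Function.Embedding.inr) with hA
  have hAl : ∀ i, Sum.inl i ∈ A → t ≤ (u i : ℕ) := fun i hi => by simpa [hA] using hi
  have hAr : ∀ j, Sum.inr j ∈ A → s ≤ (v j : ℕ) ∧ (v j : ℕ) < t := fun j hj => by
    simpa [hA] using hj
  have hAcard : cntGE P s < A.card := by
    have h2 : (Finset.univ.filter fun i => t ≤ (u i : ℕ)).card = cntGE I t := by
      rw [← cntGE_image u.injective, hu]
    have h3 : cntGE C t + (Finset.univ.filter fun j => s ≤ (v j : ℕ) ∧ (v j : ℕ) < t).card =
        cntGE C s := by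
      rw [cntGE_eq_add C hst, ← hv, Finset.filter_image,
        Finset.card_image_of_injective _ v.injective]
    rw [hA, Finset.card_union_of_disjoint, Finset.card_map, Finset.card_map, h2]
    · omega
    · rw [Finset.disjoint_left]
      rintro x hx hx'
      obtain ⟨i, _, rfl⟩ := Finset.mem_map.1 hx
      simp at hx'
  set Good : Finset (Fin n) → Finset (Fin n) → Prop := fun I' C' =>
    ¬ GaleLE I' P ∨ ∑ x ∈ C, (x : ℕ) < ∑ x ∈ C', (x : ℕ)
  change _ ∈ Submodule.span K {p | ∃ I' C' : Finset (Fin n), I'.card = q ∧ C'.card = r ∧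
    Good I' C' ∧ p = initialMinor K I' * initialMinor K C'}
  set W := Submodule.span K {p | ∃ I' C' : Finset (Fin n), I'.card = q ∧ C'.card = r ∧
    Good I' C' ∧ p = initialMinor K I' * initialMinor K C'}
  -- When all rows of `A` stand in the first factor, it has too many values from `s` on to be below
  -- `P`.
  have hE : altSum K hq hr A z ∈ W := by
    refine Submodule.span_le.2 ?_ (altSum_mem_span hq hr hCI A z)
    rintro _ ⟨τ, hτ, rfl⟩
    refine pairMinor_mem_span hq hr _ Good fun hi _ => Or.inl fun hle => ?_
    have h1 := hle s
    rw [cntGE_image hi] at h1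
    have h2 : A ⊆ (Finset.univ.filter fun i => s ≤ (((z ∘ τ) ∘ Sum.inl) i : ℕ)).image
        (fun i => τ (Sum.inl i)) := by
      intro a ha
      obtain ⟨i, hi⟩ := hτ a ha
      refine Finset.mem_image.2 ⟨i, ?_, hi⟩
      rw [Finset.mem_filter]
      refine ⟨Finset.mem_univ _, ?_⟩
      simp only [Function.comp_apply, hi]
      cases a with
      | inl i => exact hst.trans (hAl i ha)
      | inr j => exact (hAr j ha).1
    have := (Finset.card_le_card h2).trans Finset.card_image_le
    omega
  unfold altSum at hE
  -- Permutations that preserve the right positions reproduce the original product. The others bring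
  -- values at least `t` to the right in place of values less than `t`, which raises the sum of the
  -- second column.
  rw [← Finset.sum_filter_add_sum_filter_not _
    (fun σ : Equiv.Perm (Fin q ⊕ Fin r) => ∀ i, ∃ j, σ (Sum.inr i) = Sum.inr j)] at hE
  have hrest := Submodule.sum_mem W (t := (Finset.univ.filter fun
      σ : Equiv.Perm (Fin q ⊕ Fin r) => ∀ x, x ∉ A → σ x = x).filter
        fun σ => ¬ ∀ i, ∃ j, σ (Sum.inr i) = Sum.inr j)
    (f := fun σ => (Equiv.Perm.sign σ : ℤ) • pairMinor K hq hr (z ∘ σ)) (by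
      intro σ hσ
      simp only [Finset.mem_filter, Finset.mem_univ, true_and] at hσ
      rw [← Int.cast_smul_eq_zsmul K]
      refine Submodule.smul_mem _ _ (pairMinor_mem_span hq hr _ Good fun _ hi => Or.inr ?_)
      rw [Finset.sum_image fun a _ b _ hab => hi hab]
      have h1 : ∑ x ∈ C, (x : ℕ) = ∑ j, (z (Sum.inr j) : ℕ) := by
        conv_lhs => rw [← hv]
        rw [Finset.sum_image fun a _ b _ hab => v.injective hab]
        rfl
      rw [h1]
      have hne := hσ.2
      push Not at hne
      exact sum_inr_lt_of_perm (fun x => (z x : ℕ)) A t hAl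
        (fun j hj => (hAr j hj).2) σ hσ.1 hne)
  have hmain := (Submodule.add_mem_iff_left W hrest).1 hE
  rw [Finset.sum_congr rfl (g := fun _ => pairMinor K hq hr z) (fun σ hσ =>
    pairMinor_sumCongr hq hr z σ (Finset.mem_filter.1 hσ).2), Finset.sum_const] at hmain
  set k := ((Finset.univ.filter fun
      σ : Equiv.Perm (Fin q ⊕ Fin r) => ∀ x, x ∉ A → σ x = x).filter
        fun σ => ∀ i, ∃ j, σ (Sum.inr i) = Sum.inr j).card
  -- The identity is among the counted permutations.
  have hk0 : (k : K) ≠ 0 := by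
    refine Nat.cast_ne_zero.2 (Finset.card_pos.2 ⟨1, ?_⟩).ne'
    simp
  have := Submodule.smul_mem W (k : K)⁻¹ hmain
  rw [← Nat.cast_smul_eq_nsmul K, smul_smul, inv_mul_cancel₀ hk0, one_smul] at this
  exact this

end InitialMinor

/-! ### The vanishing ideals of Schubert varieties -/

section Schubert

open MvPolynomial

variable (K : Type*) [Field K] {n : ℕ}

/-- The set of the first `q` values of a permutation. -/
def permSet (w : Equiv.Perm (Fin n)) (q : ℕ) : Finset (Fin n) :=
  Finset.univ.filter fun x => (w.symm x : ℕ) < q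

theorem mem_permSet {w : Equiv.Perm (Fin n)} {q : ℕ} {x : Fin n} :
    x ∈ permSet w q ↔ (w.symm x : ℕ) < q := by simp [permSet]

theorem permSet_eq_image (w : Equiv.Perm (Fin n)) {q : ℕ} (hq : q ≤ n) :
    permSet w q = Finset.univ.image fun a : Fin q => w (Fin.castLE hq a) := by
  ext x
  simp only [mem_permSet, Finset.mem_image, Finset.mem_univ, true_and]
  constructor
  · intro h
    exact ⟨⟨w.symm x, h⟩, by simp⟩
  · rintro ⟨a, rfl⟩
    simp

theorem injective_perm_castLE (w : Equiv.Perm (Fin n)) {q : ℕ} (hq : q ≤ n) :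
    Function.Injective fun a : Fin q => w (Fin.castLE hq a) :=
  w.injective.comp (Fin.castLE_injective hq)

theorem card_permSet (w : Equiv.Perm (Fin n)) {q : ℕ} (hq : q ≤ n) : (permSet w q).card = q := by
  rw [permSet_eq_image w hq, Finset.card_image_of_injective _ (injective_perm_castLE w hq),
    Finset.card_univ, Fintype.card_fin]

/-- The pull-back of polynomials under `(b, u) ↦ b w u`, for upper triangular matrices `b` and `u`
and the permutation matrix `w`. -/
noncomputable def schubertMap (w : Equiv.Perm (Fin n)) :
    MvPolynomial (Fin n × Fin n) K →ₐ[K]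
      MvPolynomial ((Fin n × Fin n) ⊕ (Fin n × Fin n)) K :=
  aeval fun ij => ∑ k, (if ij.1 ≤ w k then X (Sum.inl (ij.1, w k)) else 0) *
    (if k ≤ ij.2 then X (Sum.inr (k, ij.2)) else 0)

/-- The prime ideal of the polynomials that vanish on the Schubert variety of `w`. -/
noncomputable def schubertIdeal (w : Equiv.Perm (Fin n)) : Ideal (MvPolynomial (Fin n × Fin n) K) :=
  RingHom.ker (schubertMap K w)

/-- The target of `schubertMap` is a domain. Primality is what permits cancelling a minor in the
independence proof. -/
instance (w : Equiv.Perm (Fin n)) : (schubertIdeal K w).IsPrime := RingHom.ker_isPrime _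

variable {K}

/-- Over an infinite field a polynomial is determined by its values. The triangular matrices may be
singular. -/
theorem mem_schubertIdeal_iff [Infinite K] {w : Equiv.Perm (Fin n)}
    {p : MvPolynomial (Fin n × Fin n) K} :
    p ∈ schubertIdeal K w ↔ ∀ B U : Fin n → Fin n → K, (∀ i j, j < i → B i j = 0) →
      (∀ i j, j < i → U i j = 0) →
      eval (fun ij : Fin n × Fin n => ∑ k, B ij.1 (w k) * U k ij.2) p = 0 := by
  have key : ∀ x : (Fin n × Fin n) ⊕ (Fin n × Fin n) → K, eval x (schubertMap K w p) =
      eval (fun ij : Fin n × Fin n => ∑ k,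
        (if ij.1 ≤ w k then x (Sum.inl (ij.1, w k)) else 0) *
          (if k ≤ ij.2 then x (Sum.inr (k, ij.2)) else 0)) p := by
    intro x
    have : (aeval x).comp (schubertMap K w) = aeval (R := K)
        (fun ij : Fin n × Fin n => ∑ k,
        (if ij.1 ≤ w k then x (Sum.inl (ij.1, w k)) else 0) *
          (if k ≤ ij.2 then x (Sum.inr (k, ij.2)) else 0)) := by
      apply algHom_ext
      intro ij
      simp only [schubertMap, AlgHom.comp_apply, aeval_X, map_sum, map_mul]
      refine Finset.sum_congr rfl fun k _ => ?_
      congr 1 <;> split_ifs <;> simp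
    have h := DFunLike.congr_fun this p
    rw [AlgHom.comp_apply, aeval_eq_eval, aeval_eq_eval] at h
    exact h
  rw [schubertIdeal, RingHom.mem_ker]
  constructor
  · intro h B U hB hU
    have h1 := key (Sum.elim (fun ij => B ij.1 ij.2) fun ij => U ij.1 ij.2)
    change schubertMap K w p = 0 at h
    rw [h, map_zero] at h1
    rw [h1]
    congr 2
    ext ij
    refine Finset.sum_congr rfl fun k _ => ?_
    congr 1
    · split_ifs with h2
      · rfl
      · exact hB _ _ (not_le.1 h2)
    · split_ifs with h2
      · rfl
      · exact hU _ _ (not_le.1 h2)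
  · intro h
    refine MvPolynomial.funext fun x => ?_
    change eval x (schubertMap K w p) = _
    rw [key, map_zero]
    exact h (fun i j => if i ≤ j then x (Sum.inl (i, j)) else 0)
      (fun i j => if i ≤ j then x (Sum.inr (i, j)) else 0)
      (fun i j hij => if_neg (not_le.2 hij)) (fun i j hij => if_neg (not_le.2 hij))

/-- Going down in the Bruhat order, the vanishing ideal becomes larger. -/
theorem schubertIdeal_le_swap [Infinite K] (w : Equiv.Perm (Fin n)) {i j : Fin n} (hij : i < j)
    (hw : w j < w i) : schubertIdeal K w ≤ schubertIdeal K (w * Equiv.swap i j) := by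
  intro p hp
  rw [mem_schubertIdeal_iff] at hp ⊢
  intro B U hB hU
  set c : Fin n × Fin n → K := fun ij => ∑ k, B ij.1 ((w * Equiv.swap i j) k) * U k ij.2 with hc
  set d : Fin n × Fin n → K := fun ij => B ij.1 (w i) * U i ij.2 with hd
  have hcurve : ∀ s : K, s ≠ 0 → eval (fun ij => c ij + s * d ij) p = 0 := by
    intro s hs
    -- Column `w i` of `B` absorbs a multiple of column `w j`, and rows `i`, `j` of `U` are changed
    -- so that the terms in `s⁻¹` cancel in the product. Triangularity survives because `w j < w i`
    -- and `i < j`.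
    have h := hp (fun a x => if x = w i then B a (w i) + s⁻¹ * B a (w j) else B a x)
      (fun m k => if m = i then s * U i k + U j k else if m = j then - (s⁻¹ * U j k) else U m k)
      ?_ ?_
    · rw [← h]
      congr 2
      ext ⟨a, k⟩
      have hji : j ∈ (Finset.univ : Finset (Fin n)).erase i := by simp [hij.ne']
      simp only [hc, hd]
      rw [← Finset.add_sum_erase _ _ (Finset.mem_univ i), ← Finset.add_sum_erase _ _ hji,
        ← Finset.add_sum_erase _ _ (Finset.mem_univ i), ← Finset.add_sum_erase _ _ hji]
      rw [Finset.sum_congr rfl (g := fun m => B a (w m) * U m k)]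
      rotate_left
      · intro m hm
        simp only [Finset.mem_erase, Finset.mem_univ, and_true] at hm
        rw [Equiv.Perm.mul_apply, Equiv.swap_apply_of_ne_of_ne hm.2 hm.1]
      rw [Finset.sum_congr rfl (s₁ := (Finset.univ.erase i).erase j) (g := fun m => B a (w m) * U m k)
        (f := fun m => (if w m = w i then B a (w i) + s⁻¹ * B a (w j) else B a (w m)) *
          (if m = i then s * U i k + U j k else if m = j then - (s⁻¹ * U j k) else U m k))]
      rotate_left
      · intro m hm
        simp only [Finset.mem_erase, Finset.mem_univ, and_true] at hm
        rw [if_neg hm.2, if_neg hm.1, if_neg (w.injective.ne hm.2)]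
      simp only [Equiv.Perm.mul_apply, Equiv.swap_apply_left, Equiv.swap_apply_right, if_true,
        if_neg hij.ne', if_neg (w.injective.ne hij.ne')]
      field_simp
      ring
    · intro a x hax
      split_ifs with h1
      · subst h1
        rw [hB _ _ hax, hB _ _ (hw.trans hax)]; ring
      · exact hB _ _ hax
    · intro m k hmk
      split_ifs with h1 h2
      · subst h1
        rw [hU _ _ hmk, hU _ _ (hmk.trans hij)]; ring
      · subst h2
        rw [hU _ _ hmk]; ring
      · exact hU _ _ hmk
  -- Along the line `c + s d` the polynomial vanishes for all `s ≠ 0`, hence also at the limit point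
  -- `s = 0`, which belongs to `w * swap i j`.
  set P : Polynomial K := aeval (fun ij => Polynomial.C (c ij) + Polynomial.X * Polynomial.C (d ij)) p
  have hPe : ∀ s : K, P.eval s = eval (fun ij => c ij + s * d ij) p := by
    intro s
    have : (Polynomial.aeval s).comp (aeval (R := K) fun ij =>
        Polynomial.C (c ij) + Polynomial.X * Polynomial.C (d ij)) =
        aeval (R := K) fun ij => c ij + s * d ij := by
      apply algHom_ext
      intro ij
      simp [mul_comm s]
    have h := DFunLike.congr_fun this p
    rw [AlgHom.comp_apply, aeval_eq_eval, Polynomial.coe_aeval_eq_eval] at h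
    exact h
  have hP0 : P = 0 := by
    refine Polynomial.eq_zero_of_infinite_isRoot P (Set.Infinite.mono (s := {0}ᶜ) ?_ ?_)
    · intro s hs
      change P.eval s = 0
      rw [hPe, hcurve s hs]
    · exact (Set.finite_singleton 0).infinite_compl
  have := hPe 0
  rw [hP0, Polynomial.eval_zero] at this
  rw [this]
  simp

theorem eval_rowMinor {q : ℕ} (hq : q ≤ n) (u : Fin q → Fin n) (x : Fin n × Fin n → K) :
    eval x (rowMinor K hq u) =
      (Matrix.of fun i j : Fin q => x (u i, Fin.castLE hq j)).det := by
  unfold rowMinor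
  rw [RingHom.map_det]
  congr 1
  ext i j
  simp

/-- An initial minor vanishes on the Schubert varieties to which its row set does not belong. -/
theorem initialMinor_mem_schubertIdeal [Infinite K] (w : Equiv.Perm (Fin n)) (S : Finset (Fin n))
    (hS : ¬ GaleLE S (permSet w S.card)) : initialMinor K S ∈ schubertIdeal K w := by
  rw [mem_schubertIdeal_iff]
  intro B U hB hU
  have hq := card_le_of_finset_fin S
  rw [initialMinor, eval_rowMinor]
  set u := S.orderEmbOfFin rfl
  -- Since `U` is upper triangular, its first `|S|` columns have nonzero entries only in the first
  -- `|S|` rows.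
  have hmul : (Matrix.of fun a b : Fin S.card => ∑ k, B (u a) (w k) * U k (Fin.castLE hq b)) =
      (Matrix.of fun a b : Fin S.card => B (u a) (w (Fin.castLE hq b))) *
        (Matrix.of fun a b : Fin S.card => U (Fin.castLE hq a) (Fin.castLE hq b)) := by
    ext a b
    simp only [Matrix.of_apply, Matrix.mul_apply]
    symm
    refine Finset.sum_of_injOn (Fin.castLE hq) ((Fin.castLE_injective hq).injOn) (by simp) ?_ ?_
    · intro k _ hk
      rw [hU, mul_zero]
      by_contra hlt
      refine hk ⟨⟨k, ?_⟩, by simp, rfl⟩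
      have := b.2
      have h2 : (k : ℕ) ≤ b := not_lt.1 hlt
      omega
    · intro k _; rfl
  rw [hmul, Matrix.det_mul, Matrix.det_apply, Finset.sum_eq_zero, zero_mul]
  intro σ _
  rw [Finset.prod_eq_zero_iff.2, smul_zero]
  -- A nonzero Leibniz term matches each element of `S` with an initial value of `w` that is at
  -- least as large, so `S` would be below `permSet w S.card`.
  by_contra hne
  push Not at hne
  apply hS
  intro t
  have hu : Finset.univ.image u = S := by simp [u]
  rw [permSet_eq_image w hq, cntGE_image (injective_perm_castLE w hq)]
  conv_lhs => rw [← hu]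
  rw [cntGE_image u.injective]
  refine Finset.card_le_card_of_injOn σ.symm ?_ σ.symm.injective.injOn
  intro a ha
  simp only [Finset.coe_filter, Finset.mem_univ, true_and, Set.mem_ofPred_eq] at ha ⊢
  have h1 := hne (σ.symm a) (Finset.mem_univ _)
  simp only [Matrix.of_apply, Equiv.apply_symm_apply] at h1
  have h2 : u a ≤ w (Fin.castLE hq (σ.symm a)) := by
    by_contra h
    exact h1 (hB _ _ (not_le.1 h))
  exact ha.trans h2

/-- At the permutation matrix itself (`b = u = 1`) this minor is, up to sign, the determinant of an
identity matrix. -/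
theorem initialMinor_permSet_notMem [Infinite K] (w : Equiv.Perm (Fin n)) {q : ℕ} (hq : q ≤ n) :
    initialMinor K (permSet w q) ∉ schubertIdeal K w := by
  intro hmem
  rw [mem_schubertIdeal_iff] at hmem
  have h0 := hmem (fun i j => if i = j then 1 else 0) (fun i j => if i = j then 1 else 0)
    (fun i j h => if_neg h.ne') (fun i j h => if_neg h.ne')
  rcases rowMinor_eq K hq (fun a => w (Fin.castLE hq a)) with h | ⟨_, e, h⟩
  all_goals
    have h1 := eval_rowMinor (K := K) hq (fun a => w (Fin.castLE hq a))
      (fun ij : Fin n × Fin n => ∑ k, (if ij.1 = w k then 1 else 0) * if k = ij.2 then 1 else 0)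
    have h2 : (Matrix.of fun i j : Fin q => ∑ k, (if w (Fin.castLE hq i) = w k then (1 : K) else 0) *
        if k = Fin.castLE hq j then 1 else 0) = 1 := by
      ext i j
      simp [Matrix.one_apply]
    rw [h2, Matrix.det_one, h] at h1
  · simp at h1
  · rw [← permSet_eq_image w hq, map_zsmul, h0, smul_zero] at h1
    exact zero_ne_one h1

end Schubert

/-! ### Insertion of a set into the sets of initial values of a permutation -/

section Meet

variable {n : ℕ}

/-- `P'` arises from `P` by replacing the smallest element that is at least `b` with `b`. -/
def IsBump (b : Fin n) (P P' : Finset (Fin n)) : Prop :=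
  ∃ p ∈ P, b ≤ p ∧ (∀ x ∈ P, b ≤ x → p ≤ x) ∧ P' = insert b (P.erase p)

/-- `P'` is the largest set that contains `C` and is below `P`. -/
structure IsMeet (P C P' : Finset (Fin n)) : Prop where
  subset : C ⊆ P'
  le : GaleLE P' P
  tight : ∀ t, ∃ s ≤ t, cntGE P s + cntGE C t ≤ cntGE P' t + cntGE C s

theorem mem_permSet_mul_swap {w : Equiv.Perm (Fin n)} {a k : Fin n} {q : ℕ} (ha : (a : ℕ) < q)
    (hk : (k : ℕ) < q) : permSet (w * Equiv.swap a k) q = permSet w q := by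
  ext x
  rw [mem_permSet, mem_permSet]
  change ((Equiv.swap a k).symm (w.symm x) : ℕ) < q ↔ _
  rw [Equiv.symm_swap, Equiv.swap_apply_def]
  split_ifs with h1 h2
  · simp [h1, ha, hk]
  · simp [h2, ha, hk]
  · rfl

theorem permSet_mul_swap {w : Equiv.Perm (Fin n)} {a k : Fin n} {q : ℕ} (ha : (a : ℕ) < q)
    (hk : q ≤ (k : ℕ)) :
    permSet (w * Equiv.swap a k) q = insert (w k) ((permSet w q).erase (w a)) := by
  ext x
  rw [mem_permSet, Finset.mem_insert, Finset.mem_erase, mem_permSet]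
  change ((Equiv.swap a k).symm (w.symm x) : ℕ) < q ↔ _
  rw [Equiv.symm_swap, Equiv.swap_apply_def]
  split_ifs with h1 h2
  · rw [Equiv.symm_apply_eq] at h1
    subst h1
    have : a ≠ k := by rintro rfl; omega
    simp [w.injective.ne this, hk]
  · rw [Equiv.symm_apply_eq] at h2
    subst h2
    simp [ha]
  · have h3 : x ≠ w k := fun h => h2 ((Equiv.symm_apply_eq _).2 h)
    have h4 : x ≠ w a := fun h => h1 ((Equiv.symm_apply_eq _).2 h)
    simp [h3, h4]

/-- Value `w a`, the least one from `b` on among the first `r`, is lowered to `b` by successive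
transpositions with later positions. Each goes down in the Bruhat order, and together they bump all
the sets with `q ≥ r` simultaneously. -/
theorem exists_isBump (K : Type*) [Field K] [Infinite K] (r : ℕ) (b : Fin n)
    (w : Equiv.Perm (Fin n)) (h : ∃ p ∈ permSet w r, b ≤ p) :
    ∃ w', schubertIdeal K w ≤ schubertIdeal K w' ∧
      ∀ q, r ≤ q → IsBump b (permSet w q) (permSet w' q) := by
  obtain ⟨a, har, hba, hmin⟩ : ∃ a : Fin n, (a : ℕ) < r ∧ b ≤ w a ∧
      ∀ x : Fin n, (x : ℕ) < r → b ≤ w x → w a ≤ w x := by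
    obtain ⟨p, hp, hmin⟩ := Finset.exists_min_image ((permSet w r).filter (b ≤ ·)) id
      (by obtain ⟨p, hp, hbp⟩ := h; exact ⟨p, Finset.mem_filter.2 ⟨hp, hbp⟩⟩)
    rw [Finset.mem_filter, mem_permSet] at hp
    refine ⟨w.symm p, hp.1, by simpa using hp.2, fun x hx hbx => ?_⟩
    have := hmin (w x) (Finset.mem_filter.2 ⟨mem_permSet.2 (by simpa using hx), hbx⟩)
    simpa using this
  clear h
  induction hm : (w a : ℕ) using Nat.strong_induction_on generalizing w with
  | _ m ih =>
    rcases eq_or_lt_of_le hba with hwa | hwa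
    · refine ⟨w, le_rfl, fun q hq => ⟨b, ?_, le_rfl, fun x _ h => h, ?_⟩⟩
      · rw [mem_permSet, hwa, Equiv.symm_apply_apply]; omega
      · rw [Finset.insert_erase]
        rw [mem_permSet, hwa, Equiv.symm_apply_apply]; omega
    -- The first position `k ≥ r` with a value in `[b, w a)`. The position of `b` qualifies: it is
    -- not among the first `r`, by the minimality of `w a`.
    · obtain ⟨k, hk, hkmin⟩ := Finset.exists_min_image
        (Finset.univ.filter fun k : Fin n => r ≤ (k : ℕ) ∧ b ≤ w k ∧ w k < w a) id
        ⟨w.symm b, by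
          simp only [Finset.mem_filter, Finset.mem_univ, true_and, Equiv.apply_symm_apply, le_refl,
            hwa, and_true]
          by_contra hlt
          have := hmin (w.symm b) (not_le.1 hlt) (by simp)
          rw [Equiv.apply_symm_apply] at this
          exact absurd hwa (not_lt.2 this)⟩
      simp only [Finset.mem_filter, Finset.mem_univ, true_and, id] at hk hkmin
      obtain ⟨hrk, hbk, hka⟩ := hk
      have hak : a < k := by rw [Fin.lt_def]; omega
      set v := w * Equiv.swap a k with hv
      have hva : v a = w k := by simp [hv]
      obtain ⟨w', hw', hb⟩ := ih (v a : ℕ) (by rw [hva, ← hm]; exact hka) v (hva ▸ hbk) (by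
          intro x hx hbx
          by_cases hxa : x = a
          · rw [hxa]
          · have hxk : x ≠ k := by rintro rfl; omega
            have hvx : v x = w x := by simp [hv, Equiv.swap_apply_of_ne_of_ne hxa hxk]
            rw [hvx] at hbx ⊢
            rw [hva]
            exact hka.le.trans (hmin x hx hbx)) rfl
      refine ⟨w', (schubertIdeal_le_swap w hak hka).trans hw', fun q hq => ?_⟩
      obtain ⟨p, hp, hbp, hpmin, heq⟩ := hb q hq
      -- If both positions precede `q`, the set is unchanged. Otherwise `w a` was replaced by `w k`;
      -- as `k` is the first candidate, `w a` is the least element from `b` on in the old set, and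
      -- replacing `w k` by `b` afterwards amounts to replacing `w a` by `b`.
      by_cases hkq : (k : ℕ) < q
      · rw [mem_permSet_mul_swap (by omega) hkq] at hp hpmin heq
        exact ⟨p, hp, hbp, hpmin, heq⟩
      · rw [permSet_mul_swap (by omega) (not_lt.1 hkq)] at hp hpmin heq
        have hamin : ∀ x ∈ permSet w q, b ≤ x → w a ≤ x := by
          intro x hx hbx
          rw [mem_permSet] at hx
          by_contra hlt
          rw [not_le] at hlt
          by_cases hxr : (w.symm x : ℕ) < r
          · have := hmin _ hxr (by simpa using hbx)
            rw [Equiv.apply_symm_apply] at this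
            exact absurd hlt (not_lt.2 this)
          · have := hkmin (w.symm x) ⟨not_lt.1 hxr, by simpa using hbx, by simpa using hlt⟩
            rw [Fin.le_def] at this
            omega
        have hpk : p = w k := by
          refine le_antisymm (hpmin _ (Finset.mem_insert_self _ _) hbk) ?_
          rcases Finset.mem_insert.1 hp with h | h
          · exact h.ge
          · exact hka.le.trans (hamin p (Finset.mem_of_mem_erase h) hbp)
        refine ⟨w a, ?_, hba, hamin, ?_⟩
        · rw [mem_permSet, Equiv.symm_apply_apply]; omega
        · rw [heq, hpk, Finset.erase_insert]
          rw [Finset.mem_erase, mem_permSet, Equiv.symm_apply_apply]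
          exact fun h => hkq h.2

/-- Adding a new maximum `b` to `C` forces `b` into the set; removing the smallest element from `b`
on is the cheapest way to make room. -/
theorem IsMeet.insert {P C P' P'' : Finset (Fin n)} {b : Fin n} (h : IsMeet P C P')
    (hb : ∀ x ∈ C, x < b) (hP : IsBump b P' P'') : IsMeet P (insert b C) P'' := by
  obtain ⟨p, hp, hbp, hmin, rfl⟩ := hP
  have hbC : b ∉ C := fun h => lt_irrefl _ (hb b h)
  have hbP : b ∉ P'.erase p := by
    intro hbP
    rw [Finset.mem_erase] at hbP
    exact hbP.1 (le_antisymm hbp (hmin b hbP.2 le_rfl))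
  have hcnt : ∀ t, cntGE (Insert.insert b (P'.erase p)) t + (if t ≤ (p : ℕ) then 1 else 0) =
      cntGE P' t + if t ≤ (b : ℕ) then 1 else 0 := by
    intro t
    rw [cntGE_insert hbP, add_right_comm, ← cntGE_insert (Finset.notMem_erase p P'),
      Finset.insert_erase hp]
  have hbp' : (b : ℕ) ≤ p := hbp
  have hC0 : ∀ t, (b : ℕ) ≤ t → cntGE C t = 0 := by
    intro t ht
    rw [cntGE, Finset.card_eq_zero, Finset.filter_eq_empty_iff]
    intro x hx
    have : (x : ℕ) < b := hb x hx
    omega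
  refine ⟨?_, ?_, ?_⟩
  · intro x hx
    rcases Finset.mem_insert.1 hx with rfl | hx
    · exact Finset.mem_insert_self _ _
    · refine Finset.mem_insert_of_mem (Finset.mem_erase.2 ⟨?_, h.subset hx⟩)
      rintro rfl
      exact absurd hbp (not_le.2 (hb _ hx))
  · intro t
    refine le_trans ?_ (h.le t)
    have := hcnt t
    split_ifs at this <;> omega
  · intro t
    have ht := hcnt t
    by_cases htb : t ≤ (b : ℕ)
    · obtain ⟨s, hst, hs⟩ := h.tight t
      refine ⟨s, hst, ?_⟩
      rw [cntGE_insert hbC, cntGE_insert hbC, if_pos htb, if_pos (hst.trans htb)]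
      rw [if_pos htb, if_pos (htb.trans hbp')] at ht
      omega
    · rw [if_neg htb] at ht
      by_cases htp : t ≤ (p : ℕ)
      -- As `t ≤ p`, the set `P'` has no element in `[b, t)`, so the witness for the threshold `b`
      -- also serves for `t`.
      · obtain ⟨s, hst, hs⟩ := h.tight b
        refine ⟨s, by omega, ?_⟩
        have hPb : cntGE P' b = cntGE P' t := by
          unfold cntGE
          congr 1
          ext x
          simp only [Finset.mem_filter]
          refine ⟨fun hx => ⟨hx.1, ?_⟩, fun hx => ⟨hx.1, by omega⟩⟩
          have h5 : p ≤ x := hmin x hx.1 hx.2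
          have h6 : (p : ℕ) ≤ x := h5
          omega
        rw [cntGE_insert hbC, cntGE_insert hbC, if_neg htb, if_pos hst]
        rw [if_pos htp] at ht
        have := hC0 t (by omega)
        omega
      · obtain ⟨s, hst, hs⟩ := h.tight t
        refine ⟨s, hst, ?_⟩
        rw [cntGE_insert hbC, cntGE_insert hbC, if_neg htb]
        rw [if_neg htp] at ht
        omega

/-- The Bruhat-largest permutation below `w` whose initial sets contain `C`. -/
theorem exists_isMeet (K : Type*) [Field K] [Infinite K] (r : ℕ) (w : Equiv.Perm (Fin n))
    (C : Finset (Fin n)) (hC : GaleLE C (permSet w r)) :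
    ∃ w', schubertIdeal K w ≤ schubertIdeal K w' ∧
      ∀ q, r ≤ q → IsMeet (permSet w q) C (permSet w' q) := by
  induction C using Finset.induction_on_max with
  | empty => exact ⟨w, le_rfl, fun q _ => ⟨Finset.empty_subset _, fun t => le_rfl,
      fun t => ⟨t, le_rfl, le_rfl⟩⟩⟩
  | insert b C hb ih =>
    have hbC : b ∉ C := fun h => lt_irrefl _ (hb b h)
    obtain ⟨w₁, hw₁, hm₁⟩ := ih fun t => (cntGE_mono (Finset.subset_insert _ _) t).trans (hC t)
    -- At the witness `s ≤ b` of tightness, `b` adds one to the count of `C`, which is still bounded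
    -- by that of `permSet w r`. This leaves room for an element from `b` on.
    have hex : ∃ p ∈ permSet w₁ r, b ≤ p := by
      obtain ⟨s, hs, h⟩ := (hm₁ r le_rfl).tight b
      have h1 := hC s
      rw [cntGE_insert hbC, if_pos hs] at h1
      have : 0 < cntGE (permSet w₁ r) b := by omega
      obtain ⟨p, hp⟩ := Finset.card_pos.1 this
      rw [Finset.mem_filter] at hp
      exact ⟨p, hp.1, hp.2⟩
    obtain ⟨w₂, hw₂, hm₂⟩ := exists_isBump K r b w₁ hex
    exact ⟨w₂, hw₁.trans hw₂, fun q hq => (hm₁ q hq).insert hb (hm₂ q hq)⟩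

end Meet

/-! ### The standard monomial basis -/

section StandardMonomial

open MvPolynomial

variable (K : Type*) [Field K] {n : ℕ}

open Classical in
/-- The Bruhat-largest permutation below `w` whose set of the first `|C|` values is `C`, up to the
choice of the first `|C|` values. -/
noncomputable def meetPerm [Infinite K] (w : Equiv.Perm (Fin n)) (C : Finset (Fin n)) :
    Equiv.Perm (Fin n) :=
  if h : GaleLE C (permSet w C.card) then (exists_isMeet K C.card w C h).choose else w

/-- The condition for a sequence of columns to be standard with respect to `w`, by recursion on the
last column. -/
def IsStandard [Infinite K] : (N : ℕ) → Equiv.Perm (Fin n) → (Fin N → Finset (Fin n)) → Prop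
  | 0, _, _ => True
  | N + 1, w, C => GaleLE (C (Fin.last N)) (permSet w (C (Fin.last N)).card) ∧
      IsStandard N (meetPerm K w (C (Fin.last N))) fun i => C i.castSucc

/-- The product of the initial minors of a sequence of columns. -/
noncomputable def columnProd {N : ℕ} (C : Fin N → Finset (Fin n)) : MvPolynomial (Fin n × Fin n) K :=
  ∏ c, initialMinor K (C c)

variable {K}

theorem schubertIdeal_le_meetPerm [Infinite K] (w : Equiv.Perm (Fin n)) (C : Finset (Fin n)) :
    schubertIdeal K w ≤ schubertIdeal K (meetPerm K w C) := by
  unfold meetPerm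
  split_ifs with h
  · exact (exists_isMeet K C.card w C h).choose_spec.1
  · exact le_rfl

theorem isMeet_meetPerm [Infinite K] {w : Equiv.Perm (Fin n)} {C : Finset (Fin n)}
    (h : GaleLE C (permSet w C.card)) {q : ℕ} (hq : C.card ≤ q) :
    IsMeet (permSet w q) C (permSet (meetPerm K w C) q) := by
  unfold meetPerm
  rw [dif_pos h]
  exact (exists_isMeet K C.card w C h).choose_spec.2 q hq

theorem permSet_meetPerm [Infinite K] {w : Equiv.Perm (Fin n)} {C : Finset (Fin n)}
    (h : GaleLE C (permSet w C.card)) : permSet (meetPerm K w C) C.card = C :=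
  (Finset.eq_of_subset_of_card_le (isMeet_meetPerm h le_rfl).subset
    (card_permSet _ (card_le_of_finset_fin C)).le).symm

theorem columnProd_snoc {N : ℕ} (C : Fin N → Finset (Fin n)) (B : Finset (Fin n)) :
    columnProd K (Fin.snoc C B : Fin (N + 1) → Finset (Fin n)) =
      columnProd K C * initialMinor K B := by
  unfold columnProd
  rw [Fin.prod_univ_castSucc]
  simp

theorem columnProd_succ {N : ℕ} (C : Fin (N + 1) → Finset (Fin n)) :
    columnProd K C = columnProd K (fun i => C i.castSucc) * initialMinor K (C (Fin.last N)) :=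
  Fin.prod_univ_castSucc _

/-- The standard monomials are linearly independent modulo the ideal of the Schubert variety. -/
theorem IsStandard.linearIndependent [Infinite K] (ζ : ℕ → ℕ) (N : ℕ) (w : Equiv.Perm (Fin n))
    (a : (Fin N → Finset (Fin n)) → K)
    (ha : ∀ C, a C ≠ 0 → IsStandard K N w C ∧ ∀ c, (C c).card = ζ c)
    (h : ∑ C, a C • columnProd K C ∈ schubertIdeal K w) (C : Fin N → Finset (Fin n)) : a C = 0 := by
  induction N generalizing w with
  | zero =>
    by_contra hC
    rw [Fintype.sum_subsingleton _ C] at h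
    simp only [columnProd, Finset.univ_eq_empty, Finset.prod_empty] at h
    refine (inferInstance : (schubertIdeal K w).IsPrime).ne_top ((Ideal.eq_top_iff_one _).2 ?_)
    have := Submodule.smul_of_tower_mem (schubertIdeal K w) (a C)⁻¹ h
    rwa [smul_smul, inv_mul_cancel₀ hC, one_smul] at this
  | succ N ih =>
    by_contra hC
    classical
    -- With the least sum of entries, `B` has no other occurring last column Gale-below it, so all
    -- their minors vanish for `w'`, where `w'[|B|] = B`.
    obtain ⟨C₀, hC₀, hmin⟩ := Finset.exists_min_image (Finset.univ.filter fun C => a C ≠ 0)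
      (fun C => ∑ x ∈ C (Fin.last N), (x : ℕ)) ⟨C, by simp [hC]⟩
    simp only [Finset.mem_filter, Finset.mem_univ, true_and] at hC₀ hmin
    set B := C₀ (Fin.last N)
    have hB : GaleLE B (permSet w B.card) := (ha C₀ hC₀).1.1
    set w' := meetPerm K w B
    have hw' : permSet w' B.card = B := permSet_meetPerm hB
    have h' := schubertIdeal_le_meetPerm w B h
    have hdvd : (∑ C : Fin N → Finset (Fin n), a (Fin.snoc C B) • columnProd K C) *
        initialMinor K B ∈ schubertIdeal K w' := by
      rw [← Finset.sum_filter_add_sum_filter_not _ fun C : Fin (N + 1) → Finset (Fin n) =>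
        C (Fin.last N) = B] at h'
      have h2 := Ideal.sum_mem (schubertIdeal K w')
        (t := Finset.univ.filter fun C : Fin (N + 1) → Finset (Fin n) => ¬ C (Fin.last N) = B)
        (f := fun C => a C • columnProd K C) (by
          intro C hC
          rw [Finset.mem_filter] at hC
          by_cases haC : a C = 0
          · rw [haC, zero_smul]; exact Ideal.zero_mem _
          · rw [columnProd_succ]
            refine Submodule.smul_of_tower_mem _ _ (Ideal.mul_mem_left _ _
              (initialMinor_mem_schubertIdeal w' _ fun hle => hC.2 ?_))
            have hcard : (C (Fin.last N)).card = B.card := by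
              rw [(ha C haC).2, (ha C₀ hC₀).2]
            rw [hcard, hw'] at hle
            exact hle.eq_of_card_of_sum hcard (hmin C haC))
      have h3 := (Ideal.add_mem_iff_left _ h2).1 h'
      convert h3 using 1
      rw [Finset.sum_mul]
      refine Finset.sum_bij' (fun C _ => (Fin.snoc C B : Fin (N + 1) → Finset (Fin n)))
        (fun C _ => fun i => C i.castSucc) ?_ ?_ ?_ ?_ ?_
      · intro C _; simp
      · intro C _; simp
      · intro C _; ext1 i; simp
      · intro C hC
        rw [Finset.mem_filter] at hC
        rw [← hC.2]
        exact Fin.snoc_init_self C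
      · intro C _
        rw [columnProd_snoc, smul_mul_assoc]
    have hB' : initialMinor K B ∉ schubertIdeal K w' := by
      have := initialMinor_permSet_notMem (K := K) w' (card_le_of_finset_fin B)
      rwa [hw'] at this
    have hsum := ((inferInstance : (schubertIdeal K w').IsPrime).mem_or_mem hdvd).resolve_right hB'
    have := ih w' (fun C => a (Fin.snoc C B)) (fun C hC => by
      have := ha _ hC
      refine ⟨?_, fun c => ?_⟩
      · have h1 := this.1.2
        simp only [Fin.snoc_last, Fin.snoc_castSucc] at h1
        exact h1
      · have h2 := this.2 c.castSucc
        rw [Fin.snoc_castSucc] at h2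
        exact h2) hsum (fun i => C₀ i.castSucc)
    refine hC₀ ?_
    rw [← this]
    congr 1
    exact (Fin.snoc_init_self C₀).symm

variable (K)

/-- The span of the products of initial minors one of which is not supported by `w`. -/
noncomputable def vanishingSpan (ζ : ℕ → ℕ) (N : ℕ) (w : Equiv.Perm (Fin n)) :
    Submodule K (MvPolynomial (Fin n × Fin n) K) :=
  Submodule.span K {p | ∃ C : Fin N → Finset (Fin n), (∀ c, (C c).card = ζ c) ∧
    (∃ c, ¬ GaleLE (C c) (permSet w (ζ c))) ∧ p = columnProd K C}

/-- The span of the standard monomials. -/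
noncomputable def standardSpan [Infinite K] (ζ : ℕ → ℕ) (N : ℕ) (w : Equiv.Perm (Fin n)) :
    Submodule K (MvPolynomial (Fin n × Fin n) K) :=
  Submodule.span K {p | ∃ C : Fin N → Finset (Fin n), (∀ c, (C c).card = ζ c) ∧
    IsStandard K N w C ∧ p = columnProd K C}

variable {K}

theorem vanishingSpan_le_schubertIdeal [Infinite K] (ζ : ℕ → ℕ) (N : ℕ) (w : Equiv.Perm (Fin n)) :
    vanishingSpan K ζ N w ≤ (schubertIdeal K w).restrictScalars K := by
  refine Submodule.span_le.2 ?_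
  rintro _ ⟨C, hC, ⟨c, hc⟩, rfl⟩
  change columnProd K C ∈ schubertIdeal K w
  unfold columnProd
  rw [← Finset.mul_prod_erase _ _ (Finset.mem_univ c)]
  refine Ideal.mul_mem_right _ _ (initialMinor_mem_schubertIdeal w _ ?_)
  rwa [hC]

/-- A product of initial minors that vanishes on the Schubert variety of `w ∧ B`, times the minor of
`B`, can be rewritten with larger last columns. -/
theorem columnProd_mul_mem_of_not_galeLE [CharZero K] {ζ : ℕ → ℕ} (hζ : Antitone ζ) {N : ℕ}
    {w w' : Equiv.Perm (Fin n)} {B : Finset (Fin n)} (hBcard : B.card = ζ N)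
    (hmeet : ∀ q, ζ N ≤ q → IsMeet (permSet w q) B (permSet w' q))
    (W : Submodule K (MvPolynomial (Fin n × Fin n) K))
    (hW : vanishingSpan K ζ (N + 1) w ≤ W)
    (hW' : ∀ C : Fin (N + 1) → Finset (Fin n), (∀ c, (C c).card = ζ c) →
      ∑ x ∈ B, (x : ℕ) < ∑ x ∈ C (Fin.last N), (x : ℕ) → columnProd K C ∈ W)
    {E : Fin N → Finset (Fin n)} (hE : ∀ c, (E c).card = ζ c)
    {c : Fin N} (hc : ¬ GaleLE (E c) (permSet w' (ζ c))) :
    columnProd K E * initialMinor K B ∈ W := by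
  have hNc : ζ N ≤ ζ c := hζ c.2.le
  have hm := hmeet (ζ c) hNc
  unfold GaleLE at hc
  push Not at hc
  obtain ⟨t, ht⟩ := hc
  -- The failure at `t` against the meet, combined with tightness, is exactly the strict inequality
  -- that the quadratic relation requires.
  obtain ⟨s, hst, hs⟩ := hm.tight t
  have hquad := initialMinor_mul_mem_span (K := K) (E c) B (permSet w (ζ c))
    (by rw [hBcard, hE]; exact hNc) hst (by omega)
  have hprod : columnProd K E * initialMinor K B =
      (∏ d ∈ Finset.univ.erase c, initialMinor K (E d)) *
        (initialMinor K (E c) * initialMinor K B) := by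
    unfold columnProd
    rw [← Finset.prod_erase_mul _ _ (Finset.mem_univ c), mul_assoc]
  rw [hprod]
  set m := ∏ d ∈ Finset.univ.erase c, initialMinor K (E d)
  have hmem := Submodule.mem_map_of_mem (f := LinearMap.mulLeft K m) hquad
  rw [LinearMap.mulLeft_apply] at hmem
  refine (Submodule.map_span_le _ _ _).2 ?_ hmem
  rintro _ ⟨I', B', hI', hB', hor, rfl⟩
  rw [LinearMap.mulLeft_apply]
  set F : Fin (N + 1) → Finset (Fin n) := Fin.snoc (Function.update E c I') B' with hF
  have hFc : ∀ d, (F d).card = ζ d := by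
    intro d
    refine Fin.lastCases ?_ (fun d => ?_) d
    · simp only [hF, Fin.snoc_last, Fin.val_last, hB', hBcard]
    · simp only [hF, Fin.snoc_castSucc, Fin.val_castSucc]
      by_cases hd : d = c
      · subst hd; simp [hI', hE]
      · simp [hd, hE]
  have hFp : m * (initialMinor K I' * initialMinor K B') = columnProd K F := by
    rw [hF, columnProd_snoc, columnProd, ← Finset.prod_erase_mul _ _ (Finset.mem_univ c), mul_assoc]
    simp only [Function.update_self]
    congr 1
    refine Finset.prod_congr rfl fun d hd => ?_
    rw [Function.update_of_ne (Finset.ne_of_mem_erase hd)]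
  rw [hFp]
  rcases hor with hor | hor
  · refine hW (Submodule.subset_span ⟨F, hFc, ⟨c.castSucc, ?_⟩, rfl⟩)
    simpa [hF] using hor
  · exact hW' F hFc (by simpa only [hF, Fin.snoc_last] using hor)

/-- The standard monomials span modulo the products that are not supported by `w`. -/
theorem columnProd_mem_standardSpan_sup [CharZero K] {ζ : ℕ → ℕ} (hζ : Antitone ζ) (N : ℕ)
    (w : Equiv.Perm (Fin n)) (C : Fin N → Finset (Fin n)) (hC : ∀ c, (C c).card = ζ c) :
    columnProd K C ∈ standardSpan K ζ N w ⊔ vanishingSpan K ζ N w := by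
  induction N generalizing w with
  | zero =>
    exact Submodule.mem_sup_left (Submodule.subset_span ⟨C, hC, trivial, rfl⟩)
  | succ N ih =>
    have hbound : ∀ B : Finset (Fin n), ∑ x ∈ B, (x : ℕ) ≤ n * n := by
      intro B
      calc ∑ x ∈ B, (x : ℕ) ≤ ∑ x ∈ B, n := Finset.sum_le_sum fun x _ => x.2.le
        _ ≤ n * n := by
          rw [Finset.sum_const, smul_eq_mul]
          exact Nat.mul_le_mul_right _ (card_le_of_finset_fin B)
    -- Straightening enlarges the sum of the last column, which is at most `n * n`.
    induction hm : n * n - ∑ x ∈ C (Fin.last N), (x : ℕ) using Nat.strong_induction_on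
      generalizing C with
    | _ m ihm =>
      set W := standardSpan K ζ (N + 1) w ⊔ vanishingSpan K ζ (N + 1) w
      set B := C (Fin.last N)
      have hBcard : B.card = ζ N := hC (Fin.last N)
      by_cases hB : GaleLE B (permSet w B.card)
      · have h1 := ih (meetPerm K w B) (fun i => C i.castSucc) fun c => hC c.castSucc
        rw [columnProd_succ]
        have h2 := Submodule.mem_map_of_mem (f := LinearMap.mulRight K (initialMinor K B)) h1
        rw [LinearMap.mulRight_apply, Submodule.map_sup] at h2
        refine (sup_le ?_ ?_ : _ ≤ W) h2
        · refine (Submodule.map_span_le _ _ _).2 ?_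
          rintro _ ⟨E, hE, hEs, rfl⟩
          rw [LinearMap.mulRight_apply, ← columnProd_snoc]
          refine Submodule.mem_sup_left (Submodule.subset_span ⟨_, fun c => ?_, ?_, rfl⟩)
          · refine Fin.lastCases ?_ (fun d => ?_) c
            · simp [hBcard]
            · simp [hE]
          · unfold IsStandard
            simp only [Fin.snoc_last, Fin.snoc_castSucc]
            exact ⟨hB, hEs⟩
        · refine (Submodule.map_span_le _ _ _).2 ?_
          rintro _ ⟨E, hE, ⟨c, hc⟩, rfl⟩
          rw [LinearMap.mulRight_apply]
          refine columnProd_mul_mem_of_not_galeLE hζ hBcard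
            (fun q hq => isMeet_meetPerm hB (hBcard.trans_le hq)) W le_sup_right ?_ hE hc
          intro F hF hlt
          refine ihm _ ?_ F hF rfl
          have := hbound (F (Fin.last N))
          omega
      · refine Submodule.mem_sup_right (Submodule.subset_span ⟨C, hC, ⟨Fin.last N, ?_⟩, rfl⟩)
        rwa [hBcard] at hB

end StandardMonomial

/-! ### Insertion of a column, adjoint to the meet with a column -/

section Insertion

variable {n : ℕ}

/-- In terms of counting functions, `v'` belongs to the smallest set that contains `C` and is above
the set of `v`. -/
structure IsInsertion (v : ℕ → ℕ) (C : Finset (Fin n)) (v' : ℕ → ℕ) : Prop where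
  le : ∀ t, v t ≤ v' t
  subset : ∀ s t, s ≤ t → v' t + cntGE C s ≤ v' s + cntGE C t
  tight : ∀ t, ∃ s, t ≤ s ∧ v' t + cntGE C s ≤ v s + cntGE C t

/-- With `γ = cntGE C`, the axioms say that `P'` counts `γ t + min_{s ≤ t} (cntGE P s - γ s)` and
that `v' t = γ t + max_{s ≥ t} (v s - γ s)`. Both sides thus say that `v s - γ s ≤ cntGE P t - γ t`
for all `t ≤ s`. -/
theorem IsInsertion.le_iff {v v' : ℕ → ℕ} {C P P' : Finset (Fin n)} (h : IsInsertion v C v')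
    (hP : IsMeet P C P') : (∀ t, v' t ≤ cntGE P t) ↔ ∀ t, v t ≤ cntGE P' t := by
  constructor
  · intro hv t
    obtain ⟨s, hst, hs⟩ := hP.tight t
    have h1 := h.subset s t hst
    have h2 := hv s
    have h3 := h.le t
    omega
  · intro hv t
    obtain ⟨s, hst, hs⟩ := h.tight t
    have h1 := cntGE_subset_diff hP.subset hst
    have h2 := hv s
    have h3 := hP.le t
    omega

/-- Standardness in terms of the sets that are found by inserting successively the columns to the
right of a column. -/
theorem isStandard_iff_of_isInsertion (K : Type*) [Field K] [Infinite K] {ζ : ℕ → ℕ}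
    (hζ : Antitone ζ) {M : ℕ} (C : ℕ → Finset (Fin n)) (hC : ∀ c < M, (C c).card = ζ c)
    (V : ℕ → ℕ → ℕ → ℕ) (hV : ∀ c < M, V c c = cntGE (C c))
    (hins : ∀ c d, c ≤ d → d + 1 < M → IsInsertion (V c d) (C (d + 1)) (V c (d + 1)))
    {N : ℕ} (hN : N ≤ M) (w : Equiv.Perm (Fin n)) :
    IsStandard K N w (fun i => C i) ↔ ∀ c < N, ∀ t, V c (N - 1) t ≤ cntGE (permSet w (ζ c)) t := by
  induction N generalizing w with
  | zero => simp [IsStandard]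
  | succ N ih =>
    have hcard := hC N (by omega)
    unfold IsStandard
    simp only [Fin.val_last, Fin.val_castSucc, Nat.add_sub_cancel]
    -- The adjunction trades the insertion of column `N` for the meet of `w` with it.
    have hstep : GaleLE (C N) (permSet w (C N).card) → ∀ c < N,
        ((∀ t, V c N t ≤ cntGE (permSet w (ζ c)) t) ↔
          ∀ t, V c (N - 1) t ≤ cntGE (permSet (meetPerm K w (C N)) (ζ c)) t) := by
      intro hle c hc
      have h1 := hins c (N - 1) (by omega) (by omega)
      rw [Nat.sub_add_cancel (by omega)] at h1
      exact h1.le_iff (isMeet_meetPerm hle (by rw [hcard]; exact hζ hc.le))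
    constructor
    · rintro ⟨hle, hstd⟩ c hc
      rw [ih (by omega)] at hstd
      rcases Nat.lt_succ_iff_lt_or_eq.1 hc with hc' | rfl
      · exact (hstep hle c hc').2 (hstd c hc')
      · rw [hV _ (by omega), ← hcard]; exact hle
    · intro h
      have hle : GaleLE (C N) (permSet w (C N).card) := by
        have := h N (Nat.lt_succ_self N)
        rwa [hV N (by omega), ← hcard] at this
      refine ⟨hle, (ih (by omega) _).2 fun c hc => (hstep hle c hc).1 (h c (by omega))⟩

/-- The successive scanning paths, with last values `A s` before a column with the values `B i`. In
this column `ℓ s` locations are unmarked when path `s` arrives, and `A' s` is its last value after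
the column. -/
structure IsScanStep (q r : ℕ) (A B ℓ A' : ℕ → ℕ) : Prop where
  anti : ∀ i j, i < j → j < q → A j < A i
  mono : ∀ i j, i < j → j < r → B i < B j
  le : r ≤ q
  row_le : ∀ i < r, A (q - 1 - i) ≤ B i
  init : ℓ 0 = r
  step : ∀ s < q, (0 < ℓ s ∧ A s ≤ B (ℓ s - 1) ∧ ℓ (s + 1) = ℓ s - 1 ∧ A' s = B (ℓ s - 1)) ∨
    (¬ (0 < ℓ s ∧ A s ≤ B (ℓ s - 1)) ∧ ℓ (s + 1) = ℓ s ∧ A' s = A s)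

namespace IsScanStep

variable {q r : ℕ} {A B ℓ A' : ℕ → ℕ}

/-- If exactly `q - s` locations are unmarked when path `s` arrives, `row_le` makes the path take
one. Hence after `q` paths the whole column is marked. -/
theorem len_le (h : IsScanStep q r A B ℓ A') (s : ℕ) (hs : s ≤ q) : ℓ s ≤ q - s ∧ ℓ s ≤ r := by
  induction s with
  | zero => have := h.init; have := h.le; omega
  | succ s ih =>
    have h1 := ih (by omega)
    rcases h.step s hs with ⟨h2, _, h3, _⟩ | ⟨h2, h3, _⟩
    · omega
    · refine ⟨?_, by omega⟩
      by_contra hlt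
      refine h2 ⟨by omega, ?_⟩
      have := h.row_le (ℓ s - 1) (by omega)
      rwa [show q - 1 - (ℓ s - 1) = s by omega] at this

theorem le_next (h : IsScanStep q r A B ℓ A') (s : ℕ) (hs : s < q) : A s ≤ A' s := by
  rcases h.step s hs with ⟨_, h2, _, h3⟩ | ⟨_, _, h3⟩
  · rw [h3]; exact h2
  · exact h3.ge

theorem next_succ_lt (h : IsScanStep q r A B ℓ A') (s : ℕ) (hs : s + 1 < q) :
    A' (s + 1) < A' s := by
  have hA := h.anti s (s + 1) (Nat.lt_succ_self s) hs
  have hl := h.len_le s (by omega)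
  rcases h.step s (by omega) with ⟨h1, h2, h3, h4⟩ | ⟨h1, h3, h4⟩ <;>
    rcases h.step (s + 1) hs with ⟨k1, k2, k3, k4⟩ | ⟨k1, k3, k4⟩
  · rw [h4, k4]
    exact h.mono _ _ (by omega) (by omega)
  · omega
  · rw [h4, k4, h3]
    by_contra hlt
    exact h1 ⟨by omega, not_lt.1 hlt⟩
  · omega

theorem next_anti (h : IsScanStep q r A B ℓ A') (i j : ℕ) (hij : i < j) (hj : j < q) :
    A' j < A' i := by
  induction j, hij using Nat.le_induction with
  | base => exact h.next_succ_lt i hj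
  | succ j hij ih => exact (h.next_succ_lt j hj).trans (ih (by omega))

/-- The number of unmarked locations falls from `r` to `0` in unit steps, so some path takes
location `i`; `len_le` bounds its index. -/
theorem exists_next_eq (h : IsScanStep q r A B ℓ A') (i : ℕ) (hi : i < r) :
    ∃ s < q, s ≤ q - 1 - i ∧ A' s = B i := by
  have key : ∀ s ≤ q, ℓ s ≤ i → ∃ s' < s, ℓ s' = i + 1 ∧ A' s' = B i := by
    intro s
    induction s with
    | zero => intro _ h1; have := h.init; omega
    | succ s ih =>
      intro hs h1
      by_cases h2 : ℓ s ≤ i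
      · obtain ⟨s', hs', h3⟩ := ih (by omega) h2
        exact ⟨s', by omega, h3⟩
      · rcases h.step s hs with ⟨h3, h4, h5, h6⟩ | ⟨h3, h4, h5⟩
        · have : ℓ s = i + 1 := by omega
          refine ⟨s, by omega, this, ?_⟩
          rw [h6, this, Nat.add_sub_cancel]
        · omega
  have hq := h.len_le q le_rfl
  obtain ⟨s, hs, h1, h2⟩ := key q le_rfl (by omega)
  have := h.len_le s hs.le
  exact ⟨s, hs, by omega, h2⟩

theorem next_row_le (h : IsScanStep q r A B ℓ A') (i : ℕ) (hi : i < r) : A' (q - 1 - i) ≤ B i := by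
  obtain ⟨s, hs, h1, h2⟩ := h.exists_next_eq i hi
  rw [← h2]
  rcases Nat.lt_or_eq_of_le h1 with h3 | h3
  · exact (h.next_anti _ _ h3 (by omega)).le
  · rw [h3]

/-- Paths only move up and every value of the column becomes a last value. Tightness says that no
path ends higher than these two conditions force. -/
theorem isInsertion (h : IsScanStep q r A B ℓ A') {C : Finset (Fin n)}
    (hC : ∀ x : Fin n, x ∈ C ↔ ∃ i < r, B i = x) (hB : ∀ i < r, B i < n) :
    IsInsertion (fun t => ((Finset.range q).filter fun s => t ≤ A s).card) C
      (fun t => ((Finset.range q).filter fun s => t ≤ A' s).card) := by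
  refine ⟨fun t => ?_, fun s t hst => ?_, fun t => ?_⟩
  · refine Finset.card_le_card fun s hs => ?_
    rw [Finset.mem_filter, Finset.mem_range] at hs ⊢
    exact ⟨hs.1, hs.2.trans (h.le_next s hs.1)⟩
  · have h1 : ((Finset.range q).filter fun i => s ≤ A' i).card =
        ((Finset.range q).filter fun i => t ≤ A' i).card +
          ((Finset.range q).filter fun i => s ≤ A' i ∧ A' i < t).card := by
      rw [← Finset.card_union_of_disjoint]
      · congr 1
        ext i
        simp only [Finset.mem_filter, Finset.mem_union, Finset.mem_range]
        omega
      · rw [Finset.disjoint_left]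
        intro i hi hi'
        rw [Finset.mem_filter] at hi hi'
        omega
    have h2 : (C.filter fun x : Fin n => s ≤ (x : ℕ) ∧ (x : ℕ) < t).card ≤
        ((Finset.range q).filter fun i => s ≤ A' i ∧ A' i < t).card := by
      rw [← Finset.card_image_of_injective _ Fin.val_injective]
      refine (Finset.card_le_card (t := ((Finset.range q).filter
        fun i => s ≤ A' i ∧ A' i < t).image A') ?_).trans Finset.card_image_le
      intro y hy
      obtain ⟨x, hx, rfl⟩ := Finset.mem_image.1 hy
      rw [Finset.mem_filter] at hx
      obtain ⟨i, hi, hix⟩ := (hC x).1 hx.1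
      obtain ⟨j, hj, _, hji⟩ := h.exists_next_eq i hi
      refine Finset.mem_image.2 ⟨j, ?_, hji.trans hix⟩
      rw [Finset.mem_filter, Finset.mem_range, hji, hix]
      exact ⟨hj, hx.2⟩
    rw [h1, cntGE_eq_add C hst]
    omega
  -- Induction over the paths, looking at the last one. If it moved, its end lies in `C`, which pays
  -- for it, and the earlier paths end strictly higher. If it stayed, the threshold `A m` works,
  -- since all the earlier `A` values exceed it.
  · have key : ∀ m ≤ q, ∀ t, (∀ s < m, t ≤ A' s) → ∃ s, t ≤ s ∧ m + cntGE C s ≤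
        ((Finset.range q).filter fun i => s ≤ A i).card + cntGE C t := by
      intro m
      induction m with
      | zero => intro _ t _; exact ⟨t, le_rfl, by omega⟩
      | succ m ih =>
        intro hm t ht
        have htm := ht m (Nat.lt_succ_self m)
        have hl := h.len_le m (by omega)
        rcases h.step m hm with ⟨h1, h2, h3, h4⟩ | ⟨h1, h3, h4⟩
        · obtain ⟨s, hs, hs'⟩ := ih (by omega) (A' m + 1) fun s hs => h.next_anti s m hs hm
          refine ⟨s, by omega, ?_⟩
          have hlt : B (ℓ m - 1) < n := hB _ (by omega)
          have hmem : (⟨B (ℓ m - 1), hlt⟩ : Fin n) ∈ C := (hC _).2 ⟨ℓ m - 1, by omega, rfl⟩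
          have h5 := cntGE_eq_add C (Nat.le_succ (A' m))
          have h6 : 0 < (C.filter fun x : Fin n =>
              A' m ≤ (x : ℕ) ∧ (x : ℕ) < (A' m).succ).card :=
            Finset.card_pos.2 ⟨_, Finset.mem_filter.2 ⟨hmem, by simp [h4]⟩⟩
          have h7 := cntGE_antitone C htm
          simp only [Nat.succ_eq_add_one] at h5 h6
          omega
        · refine ⟨A m, by omega, ?_⟩
          have h5 := cntGE_antitone C (show t ≤ A m by omega)
          have h6 : Finset.range (m + 1) ⊆ (Finset.range q).filter fun i => A m ≤ A i := by
            intro i hi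
            rw [Finset.mem_range] at hi
            rw [Finset.mem_filter, Finset.mem_range]
            refine ⟨by omega, ?_⟩
            rcases Nat.lt_succ_iff_lt_or_eq.1 hi with h' | rfl
            · exact (h.anti _ _ h' (by omega)).le
            · exact le_rfl
          have h7 := Finset.card_le_card h6
          rw [Finset.card_range] at h7
          omega
    refine key _ ((Finset.card_filter_le _ _).trans_eq (Finset.card_range q)) t fun s hs => ?_
    by_contra hlt
    have h1 : ((Finset.range q).filter fun i => t ≤ A' i) ⊆ Finset.range s := by
      intro i hi
      rw [Finset.mem_filter, Finset.mem_range] at hi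
      rw [Finset.mem_range]
      by_contra hsi
      rcases Nat.lt_or_eq_of_le (not_lt.1 hsi) with h' | rfl
      · have := h.next_anti _ _ h' hi.1; omega
      · omega
    have := Finset.card_le_card h1
    rw [Finset.card_range] at this
    omega

end IsScanStep

end Insertion

/-! ### The scanning paths, column by column -/

section Scanning

/-- The last column before column `c + k + 1` that a scanning path from column `c` meets. -/
def scanLast (val len : ℕ → ℕ) (c : ℕ) : ℕ → ℕ
  | 0 => c
  | k + 1 => if 0 < len (c + 1 + k) ∧ val (scanLast val len c k) ≤ val (c + 1 + k) then c + 1 + k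
      else scanLast val len c k

theorem ewisFrom_append (val : ℕ → ℕ) (a : ℕ) (l l' : List ℕ) :
    ewisFrom val a (l ++ l') =
      ewisFrom val a l ++ ewisFrom val ((ewisFrom val a l).getLastD a) l' := by
  induction l generalizing a with
  | nil => rfl
  | cons b l ih =>
    simp only [List.cons_append, ewisFrom]
    split_ifs
    · rw [ih, List.cons_append, List.getLastD_cons]
    · exact ih a

theorem ewisFrom_range' (val len : ℕ → ℕ) (c k : ℕ) :
    ewisFrom val c ((List.range' (c + 1) (k + 1)).filter fun j => 0 < len j) =
      ewisFrom val c ((List.range' (c + 1) k).filter fun j => 0 < len j) ++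
        if 0 < len (c + 1 + k) ∧ val ((ewisFrom val c
          ((List.range' (c + 1) k).filter fun j => 0 < len j)).getLastD c) ≤ val (c + 1 + k)
        then [c + 1 + k] else [] := by
  rw [List.range'_1_concat, List.filter_append, ewisFrom_append]
  congr 1
  by_cases h : 0 < len (c + 1 + k)
  · simp [h, ewisFrom]
  · simp [h, ewisFrom]

theorem getLastD_ewisFrom (val len : ℕ → ℕ) (c k : ℕ) :
    (ewisFrom val c ((List.range' (c + 1) k).filter fun j => 0 < len j)).getLastD c =
      scanLast val len c k := by
  induction k with
  | zero => rfl
  | succ k ih =>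
    rw [ewisFrom_range', ih, scanLast]
    by_cases h : 0 < len (c + 1 + k) ∧ val (scanLast val len c k) ≤ val (c + 1 + k)
    · rw [if_pos h, if_pos h]; simp
    · rw [if_neg h, if_neg h, List.append_nil, ih]

/-- Whether a column is met depends only on the columns before it, so the marking can be followed
one column at a time for all paths, instead of one path at a time. -/
theorem mem_ewisFrom_iff (val len : ℕ → ℕ) (c k m : ℕ) (hk : k < m) :
    c + 1 + k ∈ ewisFrom val c ((List.range' (c + 1) m).filter fun j => 0 < len j) ↔
      0 < len (c + 1 + k) ∧ val (scanLast val len c k) ≤ val (c + 1 + k) := by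
  have hsub : ∀ (l : List ℕ) (a x : ℕ), x ∈ ewisFrom val a l → x ∈ l := by
    intro l
    induction l with
    | nil => intro a x hx; exact hx
    | cons b l ih =>
      intro a x hx
      simp only [ewisFrom] at hx
      split_ifs at hx
      · rcases List.mem_cons.1 hx with rfl | hx
        · exact List.mem_cons_self
        · exact List.mem_cons_of_mem _ (ih _ _ hx)
      · exact List.mem_cons_of_mem _ (ih _ _ hx)
  induction m, hk using Nat.le_induction with
  | base =>
    rw [ewisFrom_range', getLastD_ewisFrom, List.mem_append]
    constructor
    · rintro (h | h)
      · have := hsub _ _ _ h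
        rw [List.mem_filter, List.mem_range'_1] at this
        omega
      · split_ifs at h with h1
        · exact h1
        · simp at h
    · intro h
      right
      rw [if_pos h]
      exact List.mem_singleton_self _
  | succ m hm ih =>
    rw [ewisFrom_range', List.mem_append]
    refine Iff.trans ?_ ih
    constructor
    · rintro (h | h)
      · exact h
      · split_ifs at h
        · rw [List.mem_singleton] at h
          omega
        · simp at h
    · exact Or.inl

theorem scanPath_eq (t : ℕ → ℕ → ℕ) {w c : ℕ} (hc : c < w) (len : ℕ → ℕ) (hlen : 0 < len c) :
    scanPath t w c len = c :: ewisFrom (fun j => t (len j - 1) j) c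
      ((List.range' (c + 1) (w - c - 1)).filter fun j => 0 < len j) := by
  unfold scanPath
  rw [show w - c = (w - c - 1) + 1 by omega, List.range'_succ, List.filter_cons_of_pos (by simpa),
    ewis, Nat.add_sub_cancel]

/-- The last value of the scanning path number `s` from column `c` before column `c + k + 1`. -/
def scanState (t : ℕ → ℕ → ℕ) (w : ℕ) (ζ : ℕ → ℕ) (c s k : ℕ) : ℕ :=
  t (scanLen t w ζ c s (scanLast (fun j => t (scanLen t w ζ c s j - 1) j) (scanLen t w ζ c s) c k)
    - 1) (scanLast (fun j => t (scanLen t w ζ c s j - 1) j) (scanLen t w ζ c s) c k)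

variable {t : ℕ → ℕ → ℕ} {w : ℕ} {ζ : ℕ → ℕ} {c : ℕ}

theorem scanLen_self (hc : c < w) (s : ℕ) (hs : s ≤ ζ c) : scanLen t w ζ c s c = ζ c - s := by
  induction s with
  | zero => rfl
  | succ s ih =>
    have h1 := ih (by omega)
    simp only [scanLen]
    rw [if_pos, h1]
    · omega
    · rw [scanPath_eq t hc _ (by omega)]
      exact List.mem_cons_self

theorem scanEntry_eq (hc : c < w) (r : ℕ) (hr : r < ζ c) :
    scanEntry t w ζ r c = scanState t w ζ c (ζ c - 1 - r) (w - c - 1) := by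
  have h1 : 0 < scanLen t w ζ c (ζ c - 1 - r) c := by rw [scanLen_self hc _ (by omega)]; omega
  unfold scanEntry
  rw [scanPath_eq t hc _ h1, List.getLast?_cons, ← List.getLastD_eq_getLast?, getLastD_ewisFrom]
  rfl

theorem scanLen_succ (hc : c < w) {s k : ℕ} (hs : s < ζ c) (hk : c + 1 + k < w) :
    (0 < scanLen t w ζ c s (c + 1 + k) ∧
      scanState t w ζ c s k ≤ t (scanLen t w ζ c s (c + 1 + k) - 1) (c + 1 + k) ∧
      scanLen t w ζ c (s + 1) (c + 1 + k) = scanLen t w ζ c s (c + 1 + k) - 1 ∧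
      scanState t w ζ c s (k + 1) = t (scanLen t w ζ c s (c + 1 + k) - 1) (c + 1 + k)) ∨
    (¬ (0 < scanLen t w ζ c s (c + 1 + k) ∧
      scanState t w ζ c s k ≤ t (scanLen t w ζ c s (c + 1 + k) - 1) (c + 1 + k)) ∧
      scanLen t w ζ c (s + 1) (c + 1 + k) = scanLen t w ζ c s (c + 1 + k) ∧
      scanState t w ζ c s (k + 1) = scanState t w ζ c s k) := by
  have h1 : 0 < scanLen t w ζ c s c := by rw [scanLen_self hc _ hs.le]; omega
  have hmem : c + 1 + k ∈ scanPath t w c (scanLen t w ζ c s) ↔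
      (0 < scanLen t w ζ c s (c + 1 + k) ∧
        scanState t w ζ c s k ≤ t (scanLen t w ζ c s (c + 1 + k) - 1) (c + 1 + k)) := by
    rw [scanPath_eq t hc _ h1, List.mem_cons, mem_ewisFrom_iff _ _ _ _ _ (by omega)]
    constructor
    · rintro (h | h)
      · omega
      · exact h
    · exact Or.inr
  by_cases h : 0 < scanLen t w ζ c s (c + 1 + k) ∧
      scanState t w ζ c s k ≤ t (scanLen t w ζ c s (c + 1 + k) - 1) (c + 1 + k)
  · refine Or.inl ⟨h.1, h.2, ?_, ?_⟩
    · simp only [scanLen]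
      rw [if_pos (hmem.2 h)]
    · have hlast : scanLast (fun j => t (scanLen t w ζ c s j - 1) j) (scanLen t w ζ c s) c (k + 1) =
          c + 1 + k := if_pos h
      rw [scanState, hlast]
  · refine Or.inr ⟨h, ?_, ?_⟩
    · simp only [scanLen]
      rw [if_neg (mt hmem.1 h)]
    · have hlast : scanLast (fun j => t (scanLen t w ζ c s j - 1) j) (scanLen t w ζ c s) c (k + 1) =
          scanLast (fun j => t (scanLen t w ζ c s j - 1) j) (scanLen t w ζ c s) c k := if_neg h
      rw [scanState, hlast]
      rfl

theorem scanState_zero (hc : c < w) {s : ℕ} (hs : s < ζ c) :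
    scanState t w ζ c s 0 = t (ζ c - 1 - s) c := by
  change t (scanLen t w ζ c s c - 1) c = _
  rw [scanLen_self hc _ hs.le]
  congr 1
  omega

theorem isScanStep_of_anti (hcol : ∀ i j d, d < w → i < j → j < ζ d → t i d < t j d)
    (hrow : ∀ i d, d + 1 < w → i < ζ (d + 1) → t i d ≤ t i (d + 1)) (hζ : Antitone ζ)
    {k : ℕ} (hk : c + (k + 1) < w)
    (hanti : ∀ i j, i < j → j < ζ c → scanState t w ζ c j k < scanState t w ζ c i k)
    (hle : ∀ i < ζ (c + k), scanState t w ζ c (ζ c - 1 - i) k ≤ t i (c + k)) :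
    IsScanStep (ζ c) (ζ (c + (k + 1))) (fun s => scanState t w ζ c s k)
      (fun i => t i (c + (k + 1))) (fun s => scanLen t w ζ c s (c + (k + 1)))
      (fun s => scanState t w ζ c s (k + 1)) where
  anti := hanti
  mono i j hij hj := hcol i j _ hk hij hj
  le := hζ (by omega)
  row_le i hi := (hle i (hi.trans_le (hζ (by omega)))).trans (hrow i (c + k) hk hi)
  init := rfl
  step s hs := by
    have := scanLen_succ (t := t) (w := w) (ζ := ζ) (c := c) (by omega) hs (k := k) (by omega)
    rwa [show c + 1 + k = c + (k + 1) by omega] at this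

/-- The hypotheses of a scanning step, strict decrease and row comparison, are reproduced by the
step itself (`next_anti`, `next_row_le`). Initially they hold because the path values are column `c`
read upwards. -/
theorem scanState_spec (hcol : ∀ i j d, d < w → i < j → j < ζ d → t i d < t j d)
    (hrow : ∀ i d, d + 1 < w → i < ζ (d + 1) → t i d ≤ t i (d + 1)) (hζ : Antitone ζ)
    (k : ℕ) (hk : c + k < w) :
    (∀ i j, i < j → j < ζ c → scanState t w ζ c j k < scanState t w ζ c i k) ∧
      ∀ i < ζ (c + k), scanState t w ζ c (ζ c - 1 - i) k ≤ t i (c + k) := by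
  induction k with
  | zero =>
    have hk : c < w := hk
    refine ⟨fun i j hij hj => ?_, fun i hi => ?_⟩
    · rw [scanState_zero hk hj, scanState_zero hk (hij.trans hj)]
      exact hcol _ _ _ hk (by omega) (by omega)
    · rw [Nat.add_zero] at hi
      rw [scanState_zero hk (by omega), show ζ c - 1 - (ζ c - 1 - i) = i by omega, Nat.add_zero]
  | succ k ih =>
    obtain ⟨h1, h2⟩ := ih (by omega)
    have hstep := isScanStep_of_anti hcol hrow hζ hk h1 h2
    exact ⟨hstep.next_anti, hstep.next_row_le⟩

theorem isScanStep_scanState (hcol : ∀ i j d, d < w → i < j → j < ζ d → t i d < t j d)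
    (hrow : ∀ i d, d + 1 < w → i < ζ (d + 1) → t i d ≤ t i (d + 1)) (hζ : Antitone ζ)
    {k : ℕ} (hk : c + (k + 1) < w) :
    IsScanStep (ζ c) (ζ (c + (k + 1))) (fun s => scanState t w ζ c s k)
      (fun i => t i (c + (k + 1))) (fun s => scanLen t w ζ c s (c + (k + 1)))
      (fun s => scanState t w ζ c s (k + 1)) :=
  isScanStep_of_anti hcol hrow hζ hk (scanState_spec hcol hrow hζ k (by omega)).1
    (scanState_spec hcol hrow hζ k (by omega)).2

/-- The counting function of an increasing sequence, in terms of its values in reverse order. -/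
theorem cntGE_image_eq_card_range {n q : ℕ} {u : Fin q → Fin n} (hu : Function.Injective u)
    {f : ℕ → ℕ} (hf : ∀ i : Fin q, f (q - 1 - i) = u i) (x : ℕ) :
    cntGE (Finset.univ.image u) x = ((Finset.range q).filter fun s => x ≤ f s).card := by
  rw [cntGE_image hu]
  refine Finset.card_bij (fun i _ => q - 1 - (i : ℕ)) ?_ ?_ ?_
  · intro i hi
    rw [Finset.mem_filter] at hi ⊢
    rw [hf, Finset.mem_range]
    exact ⟨by have := i.2; omega, hi.2⟩
  · intro i _ j _ hij
    have := i.2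
    have := j.2
    exact Fin.ext (by omega)
  · intro s hs
    rw [Finset.mem_filter, Finset.mem_range] at hs
    refine ⟨⟨q - 1 - s, by omega⟩, ?_, ?_⟩
    · rw [Finset.mem_filter, ← hf]
      refine ⟨Finset.mem_univ _, ?_⟩
      rw [show q - 1 - (q - 1 - s) = s by omega]
      exact hs.2
    · change q - 1 - (q - 1 - s) = s
      omega

/-- The values of an increasing sequence in reverse order. -/
theorem exists_reverse_sequence {n q : ℕ} (u : Fin q ↪o Fin n) :
    ∃ f : ℕ → ℕ, (∀ i : Fin q, f (q - 1 - i) = u i) ∧ ∀ i j, i < j → j < q → f j < f i := by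
  refine ⟨fun s => if h : s < q then u ⟨q - 1 - s, by omega⟩ else 0, fun i => ?_,
    fun i j hij hj => ?_⟩
  · have := i.2
    dsimp only
    rw [dif_pos (by omega)]
    congr 2
    exact Fin.ext (show q - 1 - (q - 1 - (i : ℕ)) = i by omega)
  · dsimp only
    rw [dif_pos hj, dif_pos (hij.trans hj)]
    exact u.strictMono (Fin.mk_lt_mk.2 (by omega))

/-- The comparison of a decreasing sequence with an increasing one, read in reverse order. -/
theorem count_le_cntGE_iff {n q : ℕ} {a : ℕ → ℕ} (ha : ∀ i j, i < j → j < q → a j < a i)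
    (u : Fin q ↪o Fin n) :
    (∀ x, ((Finset.range q).filter fun s => x ≤ a s).card ≤ cntGE (Finset.univ.image u) x) ↔
      ∀ r : Fin q, a (q - 1 - r) ≤ u r := by
  obtain ⟨f, hfu, hf⟩ := exists_reverse_sequence u
  simp only [cntGE_image_eq_card_range u.injective hfu]
  rw [count_le_iff_forall_le ha hf]
  constructor
  · intro h r
    rw [← hfu]
    exact h _ (by have := r.2; omega)
  · intro h s hs
    have := h ⟨q - 1 - s, by omega⟩
    rw [← hfu] at this
    rwa [show q - 1 - (q - 1 - s) = s by omega] at this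

theorem galeLE_image_iff {n q : ℕ} (u v : Fin q ↪o Fin n) :
    GaleLE (Finset.univ.image u) (Finset.univ.image v) ↔ ∀ r, u r ≤ v r := by
  obtain ⟨f, hfu, hf⟩ := exists_reverse_sequence u
  have h := count_le_cntGE_iff hf v
  simp only [← cntGE_image_eq_card_range u.injective hfu, hfu] at h
  exact h

end Scanning

/-! ### Tabloids as sequences of columns -/

namespace Tabloid

variable {n : ℕ} {lam : Fin n → ℕ}

theorem colLen_antitone (lam : Fin n → ℕ) : Antitone (colLen lam) := by
  intro c d hcd
  refine Finset.card_le_card fun r hr => ?_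
  rw [Finset.mem_filter] at hr ⊢
  exact ⟨hr.1, by omega⟩

/-- The set of the values in column `c`. -/
def colSet (T : Tabloid lam) (c : ℕ) : Finset (Fin n) :=
  if h : c < numCols lam then Finset.univ.image (T ⟨c, h⟩) else ∅

theorem colSet_of_lt (T : Tabloid lam) {c : ℕ} (hc : c < numCols lam) :
    T.colSet c = Finset.univ.image (T ⟨c, hc⟩) := dif_pos hc

theorem card_colSet (T : Tabloid lam) {c : ℕ} (hc : c < numCols lam) :
    (T.colSet c).card = colLen lam c := by
  rw [colSet_of_lt T hc, Finset.card_image_of_injective _ (T ⟨c, hc⟩).injective, Finset.card_univ,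
    Fintype.card_fin]

theorem entry_of_lt (T : Tabloid lam) {r c : ℕ} (hc : c < numCols lam) (hr : r < colLen lam c) :
    T.entry r c = T ⟨c, hc⟩ ⟨r, hr⟩ := dif_pos ⟨hc, hr⟩

theorem entry_lt_entry (T : Tabloid lam) (i j d : ℕ) (hd : d < numCols lam) (hij : i < j)
    (hj : j < colLen lam d) : T.entry i d < T.entry j d := by
  rw [entry_of_lt T hd hj, entry_of_lt T hd (hij.trans hj)]
  exact (T ⟨d, hd⟩).strictMono (Fin.mk_lt_mk.2 hij)

theorem IsTableau.entry_le {T : Tabloid lam} (hT : T.IsTableau) (i d : ℕ)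
    (hd : d + 1 < numCols lam) (hi : i < colLen lam (d + 1)) : T.entry i d ≤ T.entry i (d + 1) := by
  have hi' := hi.trans_le (colLen_antitone lam (Nat.le_succ d))
  rw [entry_of_lt T hd hi, entry_of_lt T (Nat.lt_of_succ_lt hd) hi']
  exact hT _ _ (Fin.mk_le_mk.2 (Nat.le_succ d)) i hi' hi

/-- For a tableau, the bound on the scanning tableau is the standardness of its columns. -/
theorem IsTableau.scanning_le_iff (K : Type*) [Field K] [Infinite K] {T : Tabloid lam}
    (hT : T.IsTableau) (w : Equiv.Perm (Fin n)) (Y : Tabloid lam)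
    (hY : ∀ c : Fin (numCols lam), Finset.univ.image (Y c) = permSet w (colLen lam c)) :
    (∀ (c : Fin (numCols lam)) (r : Fin (colLen lam c)), T.scanning r c ≤ (Y c r : ℕ)) ↔
      IsStandard K (numCols lam) w fun c => T.colSet c := by
  -- The counting function of the last values that the paths from column `c` have after column `d`.
  set V : ℕ → ℕ → ℕ → ℕ := fun c d x => ((Finset.range (colLen lam c)).filter fun s =>
    x ≤ scanState T.entry (numCols lam) (colLen lam) c s (d - c)).card with hV
  have hζ := colLen_antitone lam
  rw [isStandard_iff_of_isInsertion K hζ (M := numCols lam) T.colSet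
    (fun c hc => T.card_colSet hc) V ?_ ?_ le_rfl w]
  · have h1 : ∀ c : Fin (numCols lam), (∀ r : Fin (colLen lam c), T.scanning r c ≤ (Y c r : ℕ)) ↔
        ∀ x, V c (numCols lam - 1) x ≤ cntGE (permSet w (colLen lam c)) x := by
      intro c
      have hc := c.2
      have h2 := count_le_cntGE_iff (scanState_spec (c := c) T.entry_lt_entry hT.entry_le hζ
        (numCols lam - 1 - c) (by omega)).1 (Y c)
      rw [hY] at h2
      rw [hV, h2]
      refine forall_congr' fun r => ?_
      rw [Tabloid.scanning, scanEntry_eq hc _ r.2,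
        show numCols lam - (c : ℕ) - 1 = numCols lam - 1 - c by omega]
    exact ⟨fun h c hc => (h1 ⟨c, hc⟩).1 (h ⟨c, hc⟩), fun h c => (h1 c).2 (h c c.2)⟩
  · intro c hc
    ext x
    rw [colSet_of_lt T hc, cntGE_image_eq_card_range (T ⟨c, hc⟩).injective
      (f := fun s => scanState T.entry (numCols lam) (colLen lam) c s (c - c))]
    rintro ⟨i, hi⟩
    have hi : i < colLen lam c := hi
    change scanState T.entry (numCols lam) (colLen lam) c (colLen lam c - 1 - i) (c - c) = _
    rw [Nat.sub_self, scanState_zero hc (by omega),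
      show colLen lam c - 1 - (colLen lam c - 1 - i) = i by omega, entry_of_lt T hc hi]
  · intro c d hcd hd
    obtain ⟨k, rfl⟩ := Nat.exists_eq_add_of_le hcd
    have hd : c + (k + 1) < numCols lam := hd
    have hstep := isScanStep_scanState (c := c) (k := k) T.entry_lt_entry hT.entry_le hζ hd
    have := hstep.isInsertion (C := T.colSet (c + (k + 1))) ?_ ?_
    · simp only [hV, Nat.add_sub_cancel_left, show c + k + 1 - c = k + 1 by omega]
      exact this
    · intro x
      rw [colSet_of_lt T hd]
      simp only [Finset.mem_image, Finset.mem_univ, true_and]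
      constructor
      · rintro ⟨i, rfl⟩
        exact ⟨i, i.2, entry_of_lt T hd i.2⟩
      · rintro ⟨i, hi, hix⟩
        rw [entry_of_lt T hd hi] at hix
        exact ⟨⟨i, hi⟩, Fin.ext hix⟩
    · intro i hi
      rw [entry_of_lt T hd hi]
      exact Fin.is_lt _

end Tabloid

/-! ### Standard sequences of columns are tableaux -/

section Tableau

variable {n : ℕ}

/-- `R` is the initial set of size `ζ c` of the meet with column `c + 1`: it contains that column,
and standardness puts column `c` below it. -/
theorem IsStandard.exists_superset (K : Type*) [Field K] [Infinite K] {ζ : ℕ → ℕ} (hζ : Antitone ζ)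
    (C : ℕ → Finset (Fin n)) {N : ℕ} (hC : ∀ c < N, (C c).card = ζ c) {w : Equiv.Perm (Fin n)}
    (h : IsStandard K N w fun c => C c) {c : ℕ} (hc : c + 1 < N) :
    ∃ R, C (c + 1) ⊆ R ∧ R.card = ζ c ∧ GaleLE (C c) R := by
  induction N generalizing w with
  | zero => omega
  | succ N ih =>
    have h2 := h.2
    have h1 := h.1
    simp only [Fin.val_last, Fin.val_castSucc] at h1 h2
    rcases Nat.lt_or_eq_of_le (Nat.le_of_lt_succ hc) with hc' | rfl
    · exact ih (fun c hc => hC c (by omega)) h2 hc'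
    · have h3 := h2.1
      simp only [Fin.val_last] at h3
      rw [hC c (by omega)] at h3
      refine ⟨_, (isMeet_meetPerm (K := K) h1 (q := ζ c) ?_).subset, card_permSet _ ?_, h3⟩
      · rw [hC _ hc]; exact hζ (Nat.le_succ c)
      · rw [← hC c (by omega)]; exact card_le_of_finset_fin _

/-- If `v i < u i`, then at least `q - i` values of `u` but at most `r - i - 1` of `v` are from `u
i` on. The other `q - r` elements of `R` cannot make up the difference. -/
theorem le_of_galeLE_superset {q r : ℕ} (u : Fin q ↪o Fin n) (v : Fin r ↪o Fin n)
    {R : Finset (Fin n)} (hv : Finset.univ.image v ⊆ R) (hR : R.card = q)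
    (hu : GaleLE (Finset.univ.image u) R) (i : ℕ) (hiq : i < q) (hir : i < r) :
    u ⟨i, hiq⟩ ≤ v ⟨i, hir⟩ := by
  by_contra hlt
  rw [not_le] at hlt
  have h1 := hu (u ⟨i, hiq⟩)
  have h2 := cntGE_subset_diff hv (Nat.zero_le (u ⟨i, hiq⟩ : ℕ))
  rw [cntGE_zero, cntGE_zero, hR, Finset.card_image_of_injective _ v.injective, Finset.card_univ,
    Fintype.card_fin, cntGE_image v.injective] at h2
  rw [cntGE_image u.injective] at h1
  have h3 := Finset.card_le_card (s := Finset.Ici (⟨i, hiq⟩ : Fin q))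
    (t := Finset.univ.filter fun j => (u ⟨i, hiq⟩ : ℕ) ≤ u j) (by
      intro j hj
      rw [Finset.mem_Ici] at hj
      exact Finset.mem_filter.2 ⟨Finset.mem_univ _, u.monotone hj⟩)
  have h4 := Finset.card_le_card (t := Finset.Ioi (⟨i, hir⟩ : Fin r))
    (s := Finset.univ.filter fun j => (u ⟨i, hiq⟩ : ℕ) ≤ v j) (by
      intro j hj
      rw [Finset.mem_filter] at hj
      rw [Finset.mem_Ioi]
      by_contra hji
      exact absurd (hlt.trans_le hj.2) (not_lt.2 (v.monotone (not_lt.1 hji))))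
  rw [Fin.card_Ici] at h3
  rw [Fin.card_Ioi] at h4
  simp only at h3 h4
  omega

variable {lam : Fin n → ℕ}

theorem Tabloid.isTableau_of_isStandard (K : Type*) [Field K] [Infinite K] {T : Tabloid lam}
    {w : Equiv.Perm (Fin n)} (h : IsStandard K (numCols lam) w fun c => T.colSet c) :
    T.IsTableau := by
  have hζ := colLen_antitone lam
  have hadj : ∀ d, d + 1 < numCols lam → ∀ i < colLen lam (d + 1),
      T.entry i d ≤ T.entry i (d + 1) := by
    intro d hd i hi
    obtain ⟨R, hsub, hcard, hle⟩ := h.exists_superset K hζ T.colSet (fun c hc => T.card_colSet hc) hd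
    have hd' : d < numCols lam := by omega
    have hi' : i < colLen lam d := hi.trans_le (hζ (Nat.le_succ d))
    rw [T.colSet_of_lt hd] at hsub
    rw [T.colSet_of_lt hd'] at hle
    rw [T.entry_of_lt hd hi, T.entry_of_lt hd' hi']
    exact le_of_galeLE_superset (T ⟨d, hd'⟩) (T ⟨d + 1, hd⟩) hsub hcard hle i hi' hi
  have hall : ∀ c d, c ≤ d → d < numCols lam → ∀ i < colLen lam d, T.entry i c ≤ T.entry i d := by
    intro c d hcd
    induction d, hcd using Nat.le_induction with
    | base => intro _ i _; exact le_rfl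
    | succ d hcd ih =>
      intro hd i hi
      exact (ih (by omega) i (hi.trans_le (hζ (Nat.le_succ d)))).trans (hadj d hd i hi)
  intro c d hcd r hc hd
  have := hall c d hcd d.2 r hd
  rw [T.entry_of_lt d.2 hd, T.entry_of_lt c.2 hc] at this
  exact this

end Tableau

/-! ### Permutations of chains -/

namespace QChain

variable {n : ℕ} {Q : Finset ℕ}

/-- A chain consists of sets of initial values of a permutation. -/
theorem exists_perm (π : QChain n Q) :
    ∃ w : Equiv.Perm (Fin n), ∀ q : Q, permSet w q = π.sets q := by
  -- Counting the sets of the chain that miss `i` and sorting by this count lists the elements of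
  -- the smaller sets first.
  set f : Fin n → ℕ := fun i => (Finset.univ.filter fun q : Q => i ∉ π.sets q).card
  have hmono := Tuple.monotone_sort f
  refine ⟨Tuple.sort f, fun q => (Finset.eq_of_subset_of_card_le ?_ ?_).symm⟩
  · intro x hx
    rw [mem_permSet]
    by_contra hlt
    rw [not_lt] at hlt
    have hqn : (q : ℕ) ≤ n := hlt.trans (Fin.is_lt _).le
    obtain ⟨y, hyq, hyP⟩ : ∃ y ∈ permSet (Tuple.sort f) q, y ∉ π.sets q := by
      by_contra hall
      push Not at hall
      have h1 : permSet (Tuple.sort f) q = π.sets q :=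
        Finset.eq_of_subset_of_card_le hall (by rw [card_permSet _ hqn, π.card_sets])
      rw [← h1, mem_permSet] at hx
      omega
    rw [mem_permSet] at hyq
    have h2 := hmono (show (Tuple.sort f).symm y ≤ (Tuple.sort f).symm x by
      rw [Fin.le_def]; omega)
    simp only [Function.comp_apply, Equiv.apply_symm_apply] at h2
    -- As the sets form a chain, every set that misses `x` also misses `y`, and the one of size `q`
    -- misses only `y`; so `x` would be sorted before `y`.
    refine absurd h2 (not_le.2 (Finset.card_lt_card ?_))
    rw [Finset.ssubset_iff_of_subset]
    · exact ⟨q, by simp [hyP], by simp [hx]⟩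
    · intro q' hq'
      rw [Finset.mem_filter] at hq' ⊢
      refine ⟨hq'.1, fun hy => ?_⟩
      rcases le_total q q' with h | h
      · exact hq'.2 (π.mono h hx)
      · exact hyP (π.mono h hy)
  · have hqn : (q : ℕ) ≤ n := by rw [← π.card_sets q]; exact card_le_of_finset_fin _
    rw [card_permSet _ hqn, π.card_sets]

theorem image_lambdaKey (π : QChain n Q) {lam : Fin n → ℕ} (hQ : colLengths lam ⊆ Q)
    {w : Equiv.Perm (Fin n)} (hw : ∀ q : Q, permSet w q = π.sets q) (c : Fin (numCols lam)) :
    Finset.univ.image (π.lambdaKey hQ c) = permSet w (colLen lam c) := by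
  have h1 : Finset.univ.image (π.lambdaKey hQ c) = π.keySet (colLen lam c) := by
    unfold lambdaKey
    rw [Finset.image_orderEmbOfFin_univ]
  have hcard := π.card_keySet hQ c
  rw [h1]
  unfold keySet at hcard ⊢
  split_ifs at hcard ⊢ with h
  · exact (hw ⟨_, h⟩).symm
  · rw [Finset.card_univ, Fintype.card_fin] at hcard
    rw [← hcard]
    symm
    rw [← Finset.card_eq_iff_eq_univ, card_permSet _ le_rfl, Fintype.card_fin]

end QChain

/-! ### The basis of the Demazure quotient -/

section Basis

variable {K : Type*} [Field K] {n : ℕ} {lam : Fin n → ℕ} {Q : Finset ℕ}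

namespace Tabloid

theorem monomial_eq_columnProd (T : Tabloid lam) :
    T.monomial K = columnProd K fun c : Fin (numCols lam) => T.colSet c := by
  refine Finset.prod_congr rfl fun c _ => ?_
  change _ = initialMinor K (T.colSet c)
  rw [T.colSet_of_lt c.2]
  exact rowMinor_orderEmb K (colLen_le lam c) (T c)

theorem exists_colSet_eq (C : Fin (numCols lam) → Finset (Fin n))
    (hC : ∀ c, (C c).card = colLen lam c) :
    ∃ T : Tabloid lam, (fun c : Fin (numCols lam) => T.colSet c) = C := by
  refine ⟨fun c => (C c).orderEmbOfFin (hC c), ?_⟩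
  ext1 c
  rw [colSet_of_lt _ c.2, Finset.image_orderEmbOfFin_univ]

theorem colSet_injective :
    Function.Injective fun (T : Tabloid lam) (c : Fin (numCols lam)) => T.colSet c := by
  intro T U h
  ext1 c
  have hc := congrFun h c
  simp only [colSet_of_lt _ c.2] at hc
  ext1 r
  refine le_antisymm ?_ ?_
  · exact (galeLE_image_iff (T c) (U c)).1 (hc ▸ fun t => le_rfl) r
  · exact (galeLE_image_iff (U c) (T c)).1 (hc ▸ fun t => le_rfl) r

theorem below_iff (T Y : Tabloid lam) (w : Equiv.Perm (Fin n))
    (hY : ∀ c : Fin (numCols lam), Finset.univ.image (Y c) = permSet w (colLen lam c)) :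
    T.Below Y ↔ ∀ c : Fin (numCols lam), GaleLE (T.colSet c) (permSet w (colLen lam c)) := by
  refine forall_congr' fun c => ?_
  rw [← hY, colSet_of_lt _ c.2]
  exact (galeLE_image_iff (T c) (Y c)).symm

end Tabloid

variable (hQ : colLengths lam ⊆ Q) (π : QChain n Q) {w : Equiv.Perm (Fin n)}

theorem isDemazure_iff_isStandard (K : Type*) [Field K] [Infinite K]
    (hw : ∀ q : Q, permSet w q = π.sets q) (T : Tabloid lam) :
    IsDemazure hQ π T ↔ IsStandard K (numCols lam) w fun c => T.colSet c := by
  constructor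
  · rintro ⟨hT, h⟩
    exact (hT.scanning_le_iff K w _ (π.image_lambdaKey hQ hw)).1 h
  · intro h
    have hT := T.isTableau_of_isStandard K h
    exact ⟨hT, (hT.scanning_le_iff K w _ (π.image_lambdaKey hQ hw)).2 h⟩

/-- This moves the relations from `Γ_λ` into the polynomial ring, where the Schubert ideals live. -/
theorem map_zSpace_eq (hw : ∀ q : Q, permSet w q = π.sets q) :
    (zSpace K hQ π).map (gammaSpace K lam).subtype =
      vanishingSpan K (colLen lam) (numCols lam) w := by
  unfold zSpace vanishingSpan
  rw [Submodule.map_span]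
  congr 1
  ext p
  constructor
  · rintro ⟨p, ⟨T, hT, hp⟩, rfl⟩
    rw [T.below_iff _ w (π.image_lambdaKey hQ hw)] at hT
    push Not at hT
    exact ⟨_, fun c => T.card_colSet c.2, hT, hp.trans T.monomial_eq_columnProd⟩
  · rintro ⟨C, hC, hc, rfl⟩
    obtain ⟨T, rfl⟩ := Tabloid.exists_colSet_eq C hC
    refine ⟨⟨T.monomial K, Submodule.subset_span ⟨T, rfl⟩⟩, ⟨T, ?_, rfl⟩,
      T.monomial_eq_columnProd⟩
    rw [T.below_iff _ w (π.image_lambdaKey hQ hw)]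
    push Not
    exact hc

variable (K)

/-- The class of the monomial of a tabloid in the Demazure quotient. -/
noncomputable def monomialClass (T : Tabloid lam) : DemazureQuotient K hQ π :=
  (zSpace K hQ π).mkQ ⟨T.monomial K, Submodule.subset_span ⟨T, rfl⟩⟩

/-- The relations lie in the Schubert ideal, so independence modulo the larger ideal suffices. -/
theorem linearIndependent_monomialClass [CharZero K] :
    LinearIndependent K fun T : demazureTableaux hQ π => monomialClass K hQ π (T : Tabloid lam) := by
  classical
  obtain ⟨w, hw⟩ := π.exists_perm
  rw [Fintype.linearIndependent_iff]
  intro g hg T₀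
  have h1 : (zSpace K hQ π).mkQ (∑ T, g T • ⟨(T : Tabloid lam).monomial K,
      Submodule.subset_span ⟨(T : Tabloid lam), rfl⟩⟩) = 0 := by
    rw [map_sum, ← hg]
    exact Finset.sum_congr rfl fun T _ => map_smul _ _ _
  rw [Submodule.mkQ_apply, Submodule.Quotient.mk_eq_zero] at h1
  have h2 := Submodule.mem_map_of_mem (f := (gammaSpace K lam).subtype) h1
  rw [map_zSpace_eq hQ π hw, map_sum] at h2
  have h3 : _ ∈ schubertIdeal K w := vanishingSpan_le_schubertIdeal _ _ _ h2
  set cols : Tabloid lam → (Fin (numCols lam) → Finset (Fin n)) := fun T c => T.colSet c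
  -- The coefficients extended by zero to all sequences of sets; by injectivity of the column sets
  -- at most one summand is nonzero.
  set a : (Fin (numCols lam) → Finset (Fin n)) → K :=
    fun C => ∑ T : demazureTableaux hQ π, if cols T = C then g T else 0 with ha
  have h4 := IsStandard.linearIndependent (colLen lam) (numCols lam) w a ?_ ?_ (cols T₀)
  · rw [ha] at h4
    simp only at h4
    rw [Finset.sum_eq_single T₀, if_pos rfl] at h4
    · exact h4
    · intro T _ hT
      exact if_neg fun h => hT (Subtype.ext (Tabloid.colSet_injective h))
    · intro h; exact absurd (Finset.mem_univ _) h
  · intro C hC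
    obtain ⟨T, _, hT⟩ := Finset.exists_ne_zero_of_sum_ne_zero hC
    have hTC : cols T = C := by
      by_contra h
      exact hT (if_neg h)
    subst hTC
    refine ⟨?_, fun c => (T : Tabloid lam).card_colSet c.2⟩
    rw [← isDemazure_iff_isStandard hQ π K hw]
    exact (Finset.mem_filter.1 T.2).2
  · convert h3 using 1
    simp only [ha, Finset.sum_smul]
    rw [Finset.sum_comm]
    apply Finset.sum_congr rfl
    intro T _
    rw [Finset.sum_eq_single (cols T)]
    · rw [if_pos rfl, map_smul]
      exact congrArg (g T • ·) (T : Tabloid lam).monomial_eq_columnProd.symm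
    · intro C _ hC
      rw [if_neg hC.symm, zero_smul]
    · intro h; exact absurd (Finset.mem_univ _) h

theorem span_monomialClass [CharZero K] :
    Submodule.span K (Set.range fun T : demazureTableaux hQ π =>
      monomialClass K hQ π (T : Tabloid lam)) = ⊤ := by
  obtain ⟨w, hw⟩ := π.exists_perm
  set S := Submodule.span K (Set.range fun T : demazureTableaux hQ π =>
      monomialClass K hQ π (T : Tabloid lam))
  set W := S.comap (zSpace K hQ π).mkQ with hW
  have hzW : zSpace K hQ π ≤ W := fun p hp => by
    rw [hW, Submodule.mem_comap, Submodule.mkQ_apply, (Submodule.Quotient.mk_eq_zero _).2 hp]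
    exact Submodule.zero_mem _
  have hstd : standardSpan K (colLen lam) (numCols lam) w ≤ W.map (gammaSpace K lam).subtype := by
    refine Submodule.span_le.2 ?_
    rintro _ ⟨C, hC, hCs, rfl⟩
    obtain ⟨T, rfl⟩ := Tabloid.exists_colSet_eq C hC
    refine ⟨⟨T.monomial K, Submodule.subset_span ⟨T, rfl⟩⟩, ?_, T.monomial_eq_columnProd⟩
    refine Submodule.subset_span ⟨⟨T, ?_⟩, rfl⟩
    classical
    exact Finset.mem_filter.2 ⟨Finset.mem_univ _, (isDemazure_iff_isStandard hQ π K hw T).2 hCs⟩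
  have hall : gammaSpace K lam ≤ W.map (gammaSpace K lam).subtype := by
    refine Submodule.span_le.2 ?_
    rintro _ ⟨T, rfl⟩
    simp only
    rw [T.monomial_eq_columnProd]
    refine (sup_le hstd ?_ : _ ≤ W.map (gammaSpace K lam).subtype)
      (columnProd_mem_standardSpan_sup (Tabloid.colLen_antitone lam) _ w _
        fun c => T.card_colSet c.2)
    rw [← map_zSpace_eq hQ π hw]
    exact Submodule.map_mono hzW
  rw [eq_top_iff]
  intro x _
  obtain ⟨p, rfl⟩ := (zSpace K hQ π).mkQ_surjective x
  obtain ⟨p', hp', heq⟩ := hall p.2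
  have : p' = p := Subtype.ext heq
  exact this ▸ hp'

/-- The basis of the Demazure quotient that is formed by the Demazure tableaux. -/
noncomputable def demazureBasis [CharZero K] :
    Module.Basis (demazureTableaux hQ π) K (DemazureQuotient K hQ π) :=
  Module.Basis.mk (linearIndependent_monomialClass K hQ π) (span_monomialClass K hQ π).ge

variable {K}

theorem Tabloid.prod_eq_prod_pow_content (T : Tabloid lam) (y : Fin n → K) :
    ∏ c, ∏ i, y (T c i) = ∏ i, y i ^ T.content i := by
  simp only [Tabloid.content, ← Finset.prod_pow_eq_pow_sum]
  rw [Finset.prod_comm]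
  refine Finset.prod_congr rfl fun c _ => ?_
  rw [← Finset.prod_fiberwise Finset.univ (T c)]
  refine Finset.prod_congr rfl fun i _ => ?_
  rw [← Finset.prod_const]
  refine Finset.prod_congr rfl fun r hr => ?_
  rw [(Finset.mem_filter.1 hr).2]

/-- The action substitutes `h⁻¹ f` and `h` has the entries `y i⁻¹`, so row `i` is multiplied by `y
i` and the weight has positive exponents. -/
theorem torusRep_torusElt_monomial (y : Fin n → Kˣ) (T : Tabloid lam) :
    torusRep K n (torusElt y) (T.monomial K) = (∏ i, (y i : K) ^ T.content i) • T.monomial K := by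
  have hX : ∀ i j, leftSubst K (diagHom K n (y⁻¹)⁻¹).1 (MvPolynomial.X (i, j)) =
      MvPolynomial.C (y i : K) * MvPolynomial.X (i, j) := by
    intro i j
    rw [leftSubst, MvPolynomial.aeval_X]
    simp only [coe_diagHom]
    rw [Finset.sum_eq_single i]
    · simp
    · intro b _ hb
      simp [Matrix.diagonal_apply_ne' _ hb]
    · simp
  have hφ : torusRep K n (torusElt y) (T.monomial K) =
      leftSubst K (diagHom K n (y⁻¹)⁻¹).1 (T.monomial K) := rfl
  rw [hφ, ← T.prod_eq_prod_pow_content]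
  unfold Tabloid.monomial
  rw [map_prod, MvPolynomial.smul_eq_C_mul, map_prod, ← Finset.prod_mul_distrib]
  refine Finset.prod_congr rfl fun c _ => ?_
  rw [AlgHom.map_det, map_prod, ← Matrix.det_mul_column]
  congr 1
  ext1 i j
  simp only [AlgHom.mapMatrix_apply, Matrix.map_apply, Matrix.of_apply, hX]

theorem demazureRep_torusElt_monomialClass (y : Fin n → Kˣ) (T : Tabloid lam) :
    demazureRep K hQ π (torusElt y) (monomialClass K hQ π T) =
      (∏ i, (y i : K) ^ T.content i) • monomialClass K hQ π T := by
  have h : gammaRep K lam (torusElt y) ⟨T.monomial K, Submodule.subset_span ⟨T, rfl⟩⟩ =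
      (∏ i, (y i : K) ^ T.content i) • ⟨T.monomial K, Submodule.subset_span ⟨T, rfl⟩⟩ :=
    Subtype.ext (torusRep_torusElt_monomial y T)
  change (zSpace K hQ π).mkQ (gammaRep K lam (torusElt y) _) = _
  rw [h, map_smul]
  rfl

end Basis

theorem mainTheorem3 {K : Type*} [Field K] [CharZero K] {n : ℕ} (hn : 2 ≤ n)
    {Q : Finset ℕ} (hQne : Q.Nonempty) (hQn : Q ⊆ Finset.Icc 1 (n - 1))
    (lam : Fin n → ℕ) (hlam : Antitone lam) (hQ : colLengths lam ⊆ Q) (π : QChain n Q)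
    (y : Fin n → Kˣ) :
    (demazureRep K hQ π).character (torusElt y) =
      ∑ T ∈ demazureTableaux hQ π, ∏ i, (y i : K) ^ T.content i := by
  classical
  -- In the basis of Demazure monomials the operator is diagonal with the weights as entries.
  rw [Representation.character, LinearMap.trace_eq_matrix_trace K (demazureBasis K hQ π),
    Matrix.trace, ← Finset.sum_coe_sort (demazureTableaux hQ π)]
  apply Finset.sum_congr rfl
  intro T _
  have hb : demazureBasis K hQ π T = monomialClass K hQ π (T : Tabloid lam) := by
    rw [demazureBasis, Module.Basis.mk_apply]
  rw [Matrix.diag_apply, LinearMap.toMatrix_apply, hb, demazureRep_torusElt_monomialClass, ← hb,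
    map_smul, Module.Basis.repr_self]
  simp
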